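/- Let $G$ be a (real, finite-dimensional, not necessarily connected) Lie group with Lie algebra $\mathfrak g$, and let $\cdot$ be an $\mathrm{Ad}$-invariant symmetric bilinear form on $\mathfrak g$ (possibly indefinite or degenerate). Let $\theta^L,\theta^R\in\Omega^1(G,\mathfrak g)$ be the left- and right-invariant Maurer–Cartan forms; for $x\in\mathfrak g$ let $x^L,x^R$ be the left- and right-invariant vector fields with value $x$ at the unit. Products of forms are $(\beta\cdot\gamma)(X,Y)=\beta(X)\cdot\gamma(Y)-\beta(Y)\cdot\gamma(X)$ and $[\beta,\gamma](X,Y)=[\beta(X),\gamma(Y)]-[\beta(Y),\gamma(X)]$ for $1$-forms, and similarly in higher degree. *The Atiyah algebroid.* Let $A\to G$ be the Lie algebroid with sections $$\Gamma(A)=\{\xi\in C^\infty(G\times\mathbb R,\mathfrak g)\mid \exists\, v_\xi\in C^\infty(G,\mathfrak g):\ \xi(g,t+1)=\mathrm{Ad}_g\,\xi(g,t)+v_\xi(g)\},$$ anchor $a:\Gamma(A)\to\mathfrak X(G)$ given by $\theta^R(a(\xi))=v_\xi$, and bracket $[\xi,\zeta]_A=-[\xi,\zeta]_{\mathfrak g}+a(\xi)\zeta-a(\zeta)\xi$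 (with $[\cdot,\cdot]_{\mathfrak g}$ the pointwise bracket). Here $\Omega^k(A)=\Gamma(\wedge^kA^*)$ is the space of alternating $C^\infty(G)$-multilinear maps $\Gamma(A)^k\to C^\infty(G)$, with the Lie algebroid differential $d$, and $a^*:\Omega^k(G)\to\Omega^k(A)$ is the pull-back. The group $G$ acts on $G$ by conjugation, with generators $x_G=x^L-x^R$, and on $A$ by $(k.\xi)(g,t)=\mathrm{Ad}_k\,\xi(k^{-1}gk,t)$, with generators $x_A=-x$. For invariant $\beta$ the equivariant differentials are $(d_G\beta)(x)=d\beta-\iota(x_G)\beta$ on $G$ and $(d_G\beta)(x)=d\beta-\iota(x_A)\beta$ on $A$. *Connections and the form $\varpi^\alpha$.* Let $L=\ker a$, with bracket $[\xi,\zeta]_L=-[\xi,\zeta]_{\mathfrak g}$ and $A$-representation $\nabla_\xi\zeta=[\xi,\zeta]_A$, and let $\widehat L=L\oplus\mathbb R$ with bracket $[(\xi_1,s_1),(\xi_2,s_2)]=\big(-[\xi_1,\xi_2]_{\mathfrak g},\int_0^1\dot\xi_1\cdot\xi_2\,dt\big)$ and $A$-representation $\widehat\nabla_\xi(\zeta,s)=\big(\nabla_\xi\zeta,\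 a(\xi)s+\int_0^1\dot\xi\cdot\zeta\,dt\big)$; let $j:L\to\widehat L$, $j(\xi)=(\xi,0)$. A smooth family $\alpha_t\in\Omega^1(G,\mathfrak g)$, $t\in\mathbb R$, with $\alpha_{t+1}=\mathrm{Ad}_g\alpha_t-\theta^R$ defines a connection $\theta^\alpha:A\to L$, $\theta^\alpha(\xi)=\xi+\alpha(a(\xi))$. For $\theta=\theta^\alpha$ put $F^\theta=d\theta-\tfrac12[\theta,\theta]_L$ and $F^{j(\theta)}=d\,j(\theta)-\tfrac12[j(\theta),j(\theta)]_{\widehat L}$, the differentials being formed with $\nabla$ and $\widehat\nabla$. The difference $F^{j(\theta)}-j(F^\theta)$ takes values in the summand $\mathbb R$ of $\widehat L$, and $$\varpi^\alpha:=F^{j(\theta^\alpha)}-j(F^{\theta^\alpha})\in\Omega^2(A).$$ Let moreover $$Q^\alpha=\tfrac12\,\theta^L\cdot\alpha_0+\tfrac12\int_0^1\alpha_t\cdot\dot\alpha_t\,dt\in\Omega^2(G),\qquad \eta=\tfrac1{12}\,\theta^L\cdot[\theta^L,\theta^L]\in\Omega^3(G),\qquad \eta_G(x)=\eta-\tfrac12(\theta^L+\theta^R)\cdot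 x,$$ and, with $\kappa_t(\xi)=-\xi_t$ for $\xi\in\Gamma(A)$, $$\varpi=-\tfrac12\int_0^1\kappa_t\cdot\dot\kappa_t\,dt-\tfrac12\,a^*\theta^L\cdot\kappa_0\in\Omega^2(A).$$ **Theorem.** 1. For every such family $\alpha$, $\ d\varpi^\alpha=a^*(\eta+dQ^\alpha)$. 2. If $\alpha$ is $G$-invariant (that is, the pull-back of $\alpha_t$ under conjugation by $k$ equals $\mathrm{Ad}_k\alpha_t$ for all $k\in G$, $t\in\mathbb R$), then $\varpi^\alpha$ and $Q^\alpha$ are $G$-invariant and $d_G\varpi^\alpha=a^*(\eta_G+d_GQ^\alpha)$. 3. The form $\varpi$ is $G$-invariant and $d_G\varpi=a^*\eta_G$; in particular $d\varpi=a^*\eta$. -/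

import Mathlib

open scoped Manifold ContDiff
noncomputable section
set_option linter.unusedSectionVars false
namespace PathFibration
section
variable {E : Type*} [NormedAddCommGroup E] [NormedSpace ℝ E]
  {H : Type*} [TopologicalSpace H] (I : ModelWithCorners ℝ E H)
  (G : Type*) [TopologicalSpace G] [ChartedSpace H G] [Group G]

/-- The Lie algebra `𝔤` of `G`: the tangent space at the unit, with the bracket of left-invariant
vector fields. -/
def LieAlg : Type _ := GroupLieAlgebra I G

instance : NormedAddCommGroup (LieAlg I G) := inferInstanceAs (NormedAddCommGroup E)
instance : NormedSpace ℝ (LieAlg I G) := inferInstanceAs (NormedSpace ℝ E)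
instance [FiniteDimensional ℝ E] : FiniteDimensional ℝ (LieAlg I G) :=
  inferInstanceAs (FiniteDimensional ℝ E)
instance : Bracket (LieAlg I G) (LieAlg I G) :=
  inferInstanceAs (Bracket (GroupLieAlgebra I G) (GroupLieAlgebra I G))

variable {G}
/-- The adjoint action: the differential at the unit of conjugation by `g`. -/
def Ad (g : G) : LieAlg I G →L[ℝ] LieAlg I G :=
  mfderiv I I (fun h : G => g * h * g⁻¹) 1

/-- The left-invariant Maurer--Cartan form at `g`. -/
def thetaL (g : G) : TangentSpace I g →L[ℝ] LieAlg I G :=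
  mfderiv I I (fun h : G => g⁻¹ * h) g

/-- The right-invariant Maurer--Cartan form at `g`. -/
def thetaR (g : G) : TangentSpace I g →L[ℝ] LieAlg I G :=
  mfderiv I I (fun h : G => h * g⁻¹) g

/-- The differential of the left translation by `g` at the unit. -/
def leftField (g : G) : LieAlg I G →L[ℝ] TangentSpace I g :=
  mfderiv I I (fun h : G => g * h) 1

/-- The differential of the right translation by `g` at the unit. -/
def rightField (g : G) : LieAlg I G →L[ℝ] TangentSpace I g :=
  mfderiv I I (fun h : G => h * g) 1

variable [LieGroup I ∞ G]

variable [I.Boundaryless]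
open VectorField Set Filter Topology

/-- Multiplication in the preferred chart around the unit. -/
def chartMul (p : E × E) : E :=
  extChartAt I (1 : G) ((extChartAt I (1 : G)).symm p.1 * (extChartAt I (1 : G)).symm p.2)

lemma mfderiv_eq_fderiv_chart {F : Type*} [NormedAddCommGroup F] [NormedSpace ℝ F] (f : G → F) (hf : MDifferentiableAt I 𝓘(ℝ, F) f 1) :
    (mfderiv I 𝓘(ℝ, F) f 1 : E →L[ℝ] F) =
      fderiv ℝ (f ∘ (extChartAt I (1 : G)).symm) (extChartAt I (1 : G) 1) := by
  refine hf.mfderiv.trans ?_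
  rw [I.range_eq_univ, fderivWithin_univ]
  rfl

lemma mul_right_smooth (g : G) : ContMDiff I I ∞ (fun h : G => h * g) := contMDiff_mul_right
lemma mul_left_smooth (g : G) : ContMDiff I I ∞ (fun h : G => g * h) := contMDiff_mul_left

lemma chart_left (g : G) (hg : g ∈ (extChartAt I (1 : G)).source) (v : E) :
    (mfderiv I 𝓘(ℝ, E) (extChartAt I (1:G)) g : E →L[ℝ] E)
      ((mfderiv I I (fun h : G => g * h) 1 : E →L[ℝ] E) v) =
    fderiv ℝ (fun y => chartMul I (G := G) (extChartAt I (1:G) g, y)) (extChartAt I (1 : G) 1) v := by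
  have h1 : MDifferentiableAt I 𝓘(ℝ, E) (extChartAt I (1:G)) g :=
    mdifferentiableAt_extChartAt (by simpa using hg)
  have h2 : MDifferentiableAt I I (fun h : G => g * h) 1 :=
    (mul_left_smooth I g).mdifferentiableAt (by simp)
  have h1' : MDifferentiableAt I 𝓘(ℝ, E) (extChartAt I (1:G)) (g * 1) := by simpa using h1
  have h3 := mfderiv_comp_apply (1 : G) h1' h2 v
  have h4 := mfderiv_eq_fderiv_chart I _ (h1'.comp (1 : G) h2)
  have : (fun y => chartMul I (G := G) (extChartAt I (1:G) g, y)) =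
      (extChartAt I (1:G)) ∘ (fun h : G => g * h) ∘ (extChartAt I (1:G)).symm := by
    ext y
    simp only [chartMul, (extChartAt I (1:G)).left_inv hg, Function.comp_apply]
  rw [this]
  have h5 : (mfderiv I 𝓘(ℝ, E) (extChartAt I (1:G)) (g * 1) : E →L[ℝ] E) =
    mfderiv I 𝓘(ℝ, E) (extChartAt I (1:G)) g := by rw [mul_one]
  rw [← h5]
  refine h3.symm.trans ?_
  exact congrArg (fun T : E →L[ℝ] E => T v) h4

lemma chart_right (g : G) (hg : g ∈ (extChartAt I (1 : G)).source) (v : E) :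
    (mfderiv I 𝓘(ℝ, E) (extChartAt I (1:G)) g : E →L[ℝ] E)
      ((mfderiv I I (fun h : G => h * g) 1 : E →L[ℝ] E) v) =
    fderiv ℝ (fun y => chartMul I (G := G) (y, extChartAt I (1:G) g)) (extChartAt I (1 : G) 1) v := by
  have h1 : MDifferentiableAt I 𝓘(ℝ, E) (extChartAt I (1:G)) g :=
    mdifferentiableAt_extChartAt (by simpa using hg)
  have h2 : MDifferentiableAt I I (fun h : G => h * g) 1 :=
    (mul_right_smooth I g).mdifferentiableAt (by simp)
  have h1' : MDifferentiableAt I 𝓘(ℝ, E) (extChartAt I (1:G)) (1 * g) := by simpa using h1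
  have h3 := mfderiv_comp_apply (1 : G) h1' h2 v
  have h4 := mfderiv_eq_fderiv_chart I _ (h1'.comp (1 : G) h2)
  have : (fun y => chartMul I (G := G) (y, extChartAt I (1:G) g)) =
      (extChartAt I (1:G)) ∘ (fun h : G => h * g) ∘ (extChartAt I (1:G)).symm := by
    ext y
    simp only [chartMul, (extChartAt I (1:G)).left_inv hg, Function.comp_apply]
  rw [this]
  have h5 : (mfderiv I 𝓘(ℝ, E) (extChartAt I (1:G)) (1 * g) : E →L[ℝ] E) =
    mfderiv I 𝓘(ℝ, E) (extChartAt I (1:G)) g := by rw [one_mul]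
  rw [← h5]
  refine h3.symm.trans ?_
  exact congrArg (fun T : E →L[ℝ] E => T v) h4


lemma chartMul_contDiffAt :
    ContDiffAt ℝ ∞ (chartMul I (G := G)) (extChartAt I (1 : G) 1, extChartAt I (1 : G) 1) := by
  rw [← contMDiffAt_iff_contDiffAt]
  have hs : ContMDiffAt 𝓘(ℝ, E) I ∞ (extChartAt I (1 : G)).symm (extChartAt I (1 : G) 1) :=
    (contMDiffOn_extChartAt_symm (1 : G)).contMDiffAt (extChartAt_target_mem_nhds (1 : G))
  have h1 : ContMDiffAt 𝓘(ℝ, E × E) I ∞ (fun p : E × E => (extChartAt I (1 : G)).symm p.1)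
      (extChartAt I (1 : G) 1, extChartAt I (1 : G) 1) :=
    ContMDiffAt.comp (I' := 𝓘(ℝ, E)) _ hs contDiff_fst.contMDiff.contMDiffAt
  have h2 : ContMDiffAt 𝓘(ℝ, E × E) I ∞ (fun p : E × E => (extChartAt I (1 : G)).symm p.2)
      (extChartAt I (1 : G) 1, extChartAt I (1 : G) 1) :=
    ContMDiffAt.comp (I' := 𝓘(ℝ, E)) _ hs contDiff_snd.contMDiff.contMDiffAt
  have h3 := h1.mul h2
  refine ContMDiffAt.comp (I' := I) _ ?_ h3
  have : ContMDiffAt I 𝓘(ℝ, E) ∞ (extChartAt I (1 : G)) 1 := contMDiffAt_extChartAt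
  convert this
  simp

lemma mfderiv_chart_self [IsManifold I 1 G] :
    (mfderiv I 𝓘(ℝ, E) (extChartAt I (1:G)) (1 : G) : E →L[ℝ] E) = ContinuousLinearMap.id ℝ E := by
  rw [mfderiv_eq_fderiv_chart I _ (mdifferentiableAt_extChartAt (by simp))]
  have : (extChartAt I (1:G)) ∘ (extChartAt I (1:G)).symm =ᶠ[𝓝 (extChartAt I (1:G) 1)] id := by
    filter_upwards [extChartAt_target_mem_nhds (I := I) (1 : G)] with x hx
    simpa using (extChartAt I (1:G)).right_inv hx
  rw [this.fderiv_eq, fderiv_id]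

lemma mpullback_chart [IsManifold I 1 G] (V : Π g : G, TangentSpace I g) (x : E) (hx : x ∈ (extChartAt I (1:G)).target) :
    (mpullbackWithin 𝓘(ℝ, E) I (extChartAt I (1:G)).symm V (range I) x : E) =
    (mfderiv I 𝓘(ℝ, E) (extChartAt I (1:G)) ((extChartAt I (1:G)).symm x) : E →L[ℝ] E)
      (V ((extChartAt I (1:G)).symm x)) := by
  rw [mpullbackWithin]
  have h1 := mfderivWithin_extChartAt_symm_comp_mfderiv_extChartAt (I := I) (x := (1:G)) hx
  have h2 := mfderiv_extChartAt_comp_mfderivWithin_extChartAt_symm (I := I) (x := (1:G)) hx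
  have := ContinuousLinearMap.inverse_eq h1 h2
  exact congrArg (fun T : E →L[ℝ] E => T (V ((extChartAt I (1:G)).symm x))) this

lemma fderiv_snd_chartMul (F : E × E → E) (x₀ : E) (hF : ContDiffAt ℝ 2 F (x₀, x₀)) :
   (∀ᶠ x in 𝓝 x₀, ∀ v, fderiv ℝ (fun y => F (x, y)) x₀ v = fderiv ℝ F (x, x₀) (0, v)) ∧ 
   (∀ᶠ x in 𝓝 x₀, ∀ v, fderiv ℝ (fun y => F (y, x)) x₀ v = fderiv ℝ F (x₀, x) (v, 0)) ∧
   DifferentiableAt ℝ (fderiv ℝ F) (x₀, x₀) := by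
  have hd : ∀ᶠ p in 𝓝 (x₀, x₀), DifferentiableAt ℝ F p := by
    filter_upwards [hF.eventually (by simp)] with p hp using hp.differentiableAt (by simp)
  refine ⟨?_, ?_, ?_⟩
  · have : Tendsto (fun x => (x, x₀)) (𝓝 x₀) (𝓝 (x₀, x₀)) := by
      apply Continuous.tendsto' <;> [fun_prop; rfl]
    filter_upwards [this.eventually hd] with x hx v
    have h := hx.hasFDerivAt.comp x₀ ((hasFDerivAt_const x x₀).prodMk (hasFDerivAt_id x₀))
    have := h.fderiv
    simp only [Function.comp_def] at this
    rw [this]; simp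
  · have : Tendsto (fun x => (x₀, x)) (𝓝 x₀) (𝓝 (x₀, x₀)) := by
      apply Continuous.tendsto' <;> [fun_prop; rfl]
    filter_upwards [this.eventually hd] with x hx v
    have h := HasFDerivAt.comp (g := F) (f := fun y => (y, x)) x₀ hx.hasFDerivAt
      ((hasFDerivAt_id x₀).prodMk (hasFDerivAt_const x x₀))
    have := h.fderiv
    simp only [Function.comp_def] at this
    rw [this]; simp
  · exact (hF.fderiv_right (m := 1) (by norm_num)).differentiableAt (by simp)


lemma pullback_inv_chart (v : E) :
    (mpullbackWithin 𝓘(ℝ, E) I (extChartAt I (1:G)).symm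
      (mulInvariantVectorField (I := I) (G := G) v) (range I) : E → E)
    =ᶠ[𝓝 (extChartAt I (1 : G) 1)]
    fun x => fderiv ℝ (chartMul I (G := G)) (x, extChartAt I (1 : G) 1) (0, v) := by
  have h1 := (fderiv_snd_chartMul (chartMul I (G := G)) _ ((chartMul_contDiffAt I).of_le
    ENat.LEInfty.out)).1
  filter_upwards [h1, extChartAt_target_mem_nhds (I := I) (1 : G)] with x hx hx'
  rw [← hx v]
  refine (mpullback_chart I _ x hx').trans ?_
  have := chart_left I ((extChartAt I (1:G)).symm x) ((extChartAt I (1:G)).map_target hx') v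
  rw [(extChartAt I (1:G)).right_inv hx'] at this
  exact this

lemma fderiv_chartMul_right (v : E) :
    fderiv ℝ (chartMul I (G := G)) (extChartAt I (1 : G) 1, extChartAt I (1 : G) 1) (0, v) = v := by
  have h1 := (fderiv_snd_chartMul (chartMul I (G := G)) _ ((chartMul_contDiffAt I).of_le
    ENat.LEInfty.out)).1.self_of_nhds v
  rw [← h1, ← chart_left I (1:G) (by simp) v, mfderiv_chart_self]
  have : (fun h : G => (1 : G) * h) = id := by ext; simp
  rw [this]
  exact congrArg (fun T : E →L[ℝ] E => T v) (mfderiv_id (I := I) (x := (1 : G)))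

lemma fderiv_chartMul_left (v : E) :
    fderiv ℝ (chartMul I (G := G)) (extChartAt I (1 : G) 1, extChartAt I (1 : G) 1) (v, 0) = v := by
  have h1 := (fderiv_snd_chartMul (chartMul I (G := G)) _ ((chartMul_contDiffAt I).of_le
    ENat.LEInfty.out)).2.1.self_of_nhds v
  rw [← h1, ← chart_right I (1:G) (by simp) v, mfderiv_chart_self]
  have : (fun h : G => h * (1 : G)) = id := by ext; simp
  rw [this]
  exact congrArg (fun T : E →L[ℝ] E => T v) (mfderiv_id (I := I) (x := (1 : G)))

/-- second derivative of the chart multiplication at the unit -/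
def chartD2 : E × E →L[ℝ] E × E →L[ℝ] E :=
  fderiv ℝ (fderiv ℝ (chartMul I (G := G))) (extChartAt I (1 : G) 1, extChartAt I (1 : G) 1)

lemma hasFDerivAt_chart_left (v : E) :
    HasFDerivAt (fun x => fderiv ℝ (chartMul I (G := G)) (x, extChartAt I (1 : G) 1) (0, v))
      (((chartD2 I (G := G)).flip (0, v)).comp (ContinuousLinearMap.inl ℝ E E))
      (extChartAt I (1 : G) 1) := by
  have h1 := (fderiv_snd_chartMul (chartMul I (G := G)) _ ((chartMul_contDiffAt I).of_le
    ENat.LEInfty.out)).2.2.hasFDerivAt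
  have h2 := HasFDerivAt.comp (g := fderiv ℝ (chartMul I (G := G)))
    (f := fun x => (x, extChartAt I (1 : G) 1)) _ h1
      ((hasFDerivAt_id _).prodMk (hasFDerivAt_const (extChartAt I (1 : G) 1) _))
  exact (h2.clm_apply (hasFDerivAt_const (0, v) _)).congr_fderiv (by ext; simp [chartD2])

lemma hasFDerivAt_chart_right (v : E → E) (v' : E →L[ℝ] E)
    (hv : HasFDerivAt v v' (extChartAt I (1 : G) 1)) :
    HasFDerivAt (fun x => fderiv ℝ (chartMul I (G := G)) (extChartAt I (1 : G) 1, x) (v x, 0))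
      (((chartD2 I (G := G)).flip (v (extChartAt I (1 : G) 1), 0)).comp
        (ContinuousLinearMap.inr ℝ E E) + v')
      (extChartAt I (1 : G) 1) := by
  have h1 := (fderiv_snd_chartMul (chartMul I (G := G)) _ ((chartMul_contDiffAt I).of_le
    ENat.LEInfty.out)).2.2.hasFDerivAt
  have h2 := HasFDerivAt.comp (g := fderiv ℝ (chartMul I (G := G)))
    (f := fun x => (extChartAt I (1 : G) 1, x)) _ h1
      ((hasFDerivAt_const (extChartAt I (1 : G) 1) _).prodMk (hasFDerivAt_id _))
  refine (h2.clm_apply (hv.prodMk (hasFDerivAt_const (0 : E) _))).congr_fderiv ?_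
  ext x
  have := fderiv_chartMul_left I (G := G) (v' x)
  simp only [chartD2, add_apply, ContinuousLinearMap.comp_apply,
    ContinuousLinearMap.prod_apply, ContinuousLinearMap.flip_apply, ContinuousLinearMap.inr_apply,
    zero_apply, Function.comp_apply, ContinuousLinearMap.id_apply, this]
  abel

lemma lieBracket_chart (v w : E) (Vc Wc : E → E)
    (f1 : Vc =ᶠ[𝓝 (extChartAt I (1 : G) 1)]
        (fun x => fderiv ℝ (chartMul I (G := G)) (x, extChartAt I (1 : G) 1) (0, v)))
    (f2 : Wc =ᶠ[𝓝 (extChartAt I (1 : G) 1)]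
        (fun x => fderiv ℝ (chartMul I (G := G)) (x, extChartAt I (1 : G) 1) (0, w))) :
    lieBracket ℝ Vc Wc (extChartAt I (1 : G) 1) =
      chartD2 I (G := G) (v, 0) (0, w) - chartD2 I (G := G) (w, 0) (0, v) := by
  rw [lieBracket, f1.fderiv_eq, f2.fderiv_eq, f1.self_of_nhds, f2.self_of_nhds,
    (hasFDerivAt_chart_left I v).fderiv, (hasFDerivAt_chart_left I w).fderiv]
  beta_reduce
  rw [fderiv_chartMul_right, fderiv_chartMul_right]
  rfl

lemma bracket_chart (v w : LieAlg I G) :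
    (⁅v, w⁆ : LieAlg I G) = chartD2 I (G := G) ((v : E), 0) (0, (w : E)) -
      chartD2 I (G := G) ((w : E), 0) (0, (v : E)) := by
  have h0 : (⁅v, w⁆ : LieAlg I G) = mlieBracket I (mulInvariantVectorField (I := I) (G := G) v)
    (mulInvariantVectorField (I := I) (G := G) w) (1 : G) := rfl
  have e1 := pullback_inv_chart I (G := G) v
  have e2 := pullback_inv_chart I (G := G) w
  have e3 : (mfderiv I 𝓘(ℝ, E) (extChartAt I (1:G)) (1 : G) : E →L[ℝ] E).inverse =
      ContinuousLinearMap.id ℝ E := by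
    exact (congrArg (fun T : E →L[ℝ] E => T.inverse) (mfderiv_chart_self I)).trans
      ContinuousLinearMap.inverse_id
  obtain ⟨Vc, Wc, f1, f2, h3⟩ : ∃ Vc Wc : E → E,
      Vc =ᶠ[𝓝 (extChartAt I (1 : G) 1)]
        (fun x => fderiv ℝ (chartMul I (G := G)) (x, extChartAt I (1 : G) 1) (0, (v : E))) ∧
      Wc =ᶠ[𝓝 (extChartAt I (1 : G) 1)]
        (fun x => fderiv ℝ (chartMul I (G := G)) (x, extChartAt I (1 : G) 1) (0, (w : E))) ∧
      (⁅v, w⁆ : LieAlg I G) = lieBracketWithin ℝ Vc Wc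
      ((extChartAt I (1:G)).symm ⁻¹' univ ∩ range I) (extChartAt I (1:G) 1) := by
    refine ⟨_, _, e1, e2, ?_⟩
    refine h0.trans ?_
    rw [← mlieBracketWithin_univ, mlieBracketWithin_apply]
    exact congrArg (fun T : E →L[ℝ] E => T _) e3
  refine h3.trans ?_
  rw [I.range_eq_univ, preimage_univ, univ_inter, lieBracketWithin_univ]
  exact lieBracket_chart I v w Vc Wc f1 f2

lemma Ad_one : Ad I (1 : G) = ContinuousLinearMap.id ℝ (LieAlg I G) := by
  have : (fun h : G => (1 : G) * h * (1 : G)⁻¹) = id := by ext; simp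
  rw [Ad, this]
  exact mfderiv_id (I := I) (x := (1 : G))

lemma Ad_mul (a b : G) (x : LieAlg I G) : Ad I (a * b) x = Ad I a (Ad I b x) := by
  have h (a : G) : MDifferentiableAt I I (fun h : G => a * h * a⁻¹) 1 :=
    ((mul_right_smooth I a⁻¹).comp (mul_left_smooth I a)).mdifferentiableAt (by simp)
  have h3 := mfderiv_comp_apply_of_eq (x := (1 : G)) (y := 1) (h a) (h b) (by simp) x
  have : (fun h : G => a * h * a⁻¹) ∘ (fun h : G => b * h * b⁻¹) =
      fun h => (a * b) * h * (a * b)⁻¹ := by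
    ext; simp [mul_assoc]
  rw [this] at h3
  exact h3

lemma rightField_Ad_aux (g : G) (w : LieAlg I G) : (mfderiv I I (fun h : G => h * g) 1 : E →L[ℝ] E) (Ad I g w) =
    (mfderiv I I (fun h : G => g * h) 1 : E →L[ℝ] E) w := by
  have h1 : MDifferentiableAt I I (fun h : G => g * h * g⁻¹) 1 :=
    ((mul_right_smooth I g⁻¹).comp (mul_left_smooth I g)).mdifferentiableAt (by simp)
  have h2 : MDifferentiableAt I I (fun h : G => h * g) 1 :=
    (mul_right_smooth I g).mdifferentiableAt (by simp)
  have h3 := mfderiv_comp_apply_of_eq (x := (1 : G)) (y := 1) h2 h1 (by simp) w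
  have : (fun h : G => h * g) ∘ (fun h : G => g * h * g⁻¹) = fun h => g * h := by
    ext; simp
  rw [this] at h3
  exact h3.symm

lemma mfderiv_Ad (v w : LieAlg I G)
    (hd : MDifferentiableAt I 𝓘(ℝ, LieAlg I G) (fun h : G => Ad I h w) 1) :
    (mfderiv I 𝓘(ℝ, LieAlg I G) (fun h : G => Ad I h w) 1 : E →L[ℝ] LieAlg I G) v = ⁅v, w⁆ := by
  have hd' : DifferentiableAt ℝ ((fun h : G => Ad I h w) ∘ (extChartAt I (1:G)).symm)
      (extChartAt I (1:G) 1) := by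
    have := hd.differentiableWithinAt_writtenInExtChartAt
    rwa [I.range_eq_univ, differentiableWithinAt_univ] at this
  rw [bracket_chart]
  have h := mfderiv_eq_fderiv_chart I _ hd
  refine (congrArg (fun T : E →L[ℝ] LieAlg I G => T v) h).trans ?_
  have k1 := hasFDerivAt_chart_right I (G := G) _ _ hd'.hasFDerivAt
  have k2 := hasFDerivAt_chart_left I (G := G) (w : E)
  have k3 : (fun x => fderiv ℝ (chartMul I (G := G)) (extChartAt I (1 : G) 1, x)
      (((fun h : G => Ad I h w) ∘ (extChartAt I (1:G)).symm) x, 0)) =ᶠ[𝓝 (extChartAt I (1:G) 1)]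
      (fun x => fderiv ℝ (chartMul I (G := G)) (x, extChartAt I (1 : G) 1) (0, w)) := by
    have h1 := (fderiv_snd_chartMul (chartMul I (G := G)) _ ((chartMul_contDiffAt I).of_le
      ENat.LEInfty.out)).1
    have h2 := (fderiv_snd_chartMul (chartMul I (G := G)) _ ((chartMul_contDiffAt I).of_le
      ENat.LEInfty.out)).2.1
    filter_upwards [h1, h2, extChartAt_target_mem_nhds (I := I) (1 : G)] with x hx hy hx'
    have c1 := chart_left I ((extChartAt I (1:G)).symm x) ((extChartAt I (1:G)).map_target hx') w
    have c2 := chart_right I ((extChartAt I (1:G)).symm x) ((extChartAt I (1:G)).map_target hx')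
      (Ad I ((extChartAt I (1:G)).symm x) w)
    rw [(extChartAt I (1:G)).right_inv hx'] at c1 c2
    refine (hy _).symm.trans (Eq.trans ?_ (hx _))
    refine c2.symm.trans (Eq.trans ?_ c1)
    exact congrArg _ (rightField_Ad_aux I _ w)
  have k4 := k1.unique (k2.congr_of_eventuallyEq k3)
  have k5 := congrArg (fun T : E →L[ℝ] E => T v) k4
  have k6 : Ad I ((extChartAt I (1:G)).symm (extChartAt I (1:G) 1)) w = w := by
    rw [extChartAt_to_inv, Ad_one]
    rfl
  have k7 : chartD2 I (G := G) (0, (v : E)) ((w : E), 0) =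
      chartD2 I (G := G) ((w : E), 0) (0, (v : E)) := by
    have := ((chartMul_contDiffAt I (G := G)).isSymmSndFDerivAt (by
      simp only [minSmoothness_of_isRCLikeNormedField]; exact ENat.LEInfty.out))
    exact this _ _
  rw [← k7]
  refine eq_sub_of_add_eq' (Eq.trans ?_ k5)
  refine congrArg₂ (· + ·) ?_ rfl
  exact congrArg (fun u : E => chartD2 I (G := G) (0, (v : E)) (u, 0)) k6.symm

/-! smoothness -/
section Partial
variable {E' H' : Type*} [NormedAddCommGroup E'] [NormedSpace ℝ E'] [TopologicalSpace H']
  {I' : ModelWithCorners ℝ E' H'} {M : Type*} [TopologicalSpace M] [ChartedSpace H' M]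
  {EN HN : Type*} [NormedAddCommGroup EN] [NormedSpace ℝ EN] [TopologicalSpace HN]
  {J : ModelWithCorners ℝ EN HN} {N : Type*} [TopologicalSpace N] [ChartedSpace HN N]
  {EX HX : Type*} [NormedAddCommGroup EX] [NormedSpace ℝ EX] [TopologicalSpace HX]
  (K : ModelWithCorners ℝ EX HX) {X : Type*} [TopologicalSpace X] [ChartedSpace HX X]

lemma partial_smooth [IsManifold K ∞ X] [IsManifold J ∞ N] [IsManifold I' ∞ M]
    (F : X × N → M) (hF : ContMDiff (K.prod J) I' ∞ F)
    (s : N → TangentBundle K X) (hs : ContMDiff J K.tangent ∞ s) :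
    ContMDiff J I'.tangent ∞ (fun p => (⟨F ((s p).1, p),
      mfderiv K I' (fun h => F (h, p)) (s p).1 (s p).2⟩ : TangentBundle I' M)) := by
  have h0 : ContMDiff J J.tangent ∞ (fun p : N => (⟨p, 0⟩ : TangentBundle J N)) :=
    Bundle.contMDiff_zeroSection ℝ (TangentSpace J)
  have h1 := hF.contMDiff_tangentMap (m := ∞) (by simp)
  have h2 := (contMDiff_equivTangentBundleProd_symm (I := K) (M := X) (I' := J) (M' := N) (n := ∞))
  have h3 := (h1.comp h2).comp (hs.prodMk h0)
  refine h3.congr fun p => ?_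
  simp only [Function.comp_apply, tangentMap, equivTangentBundleProd, Equiv.coe_fn_symm_mk]
  congr 1
  refine Eq.symm ((mfderiv_prod_eq_add_apply (hF.mdifferentiableAt (by simp))).trans ?_)
  exact (congrArg₂ (· + ·) rfl (map_zero (mfderiv J I' (fun z => F ((s p).1, z)) p))).trans
    (add_zero _)

end Partial

section Smooth
variable {E' H' : Type*} [NormedAddCommGroup E'] [NormedSpace ℝ E'] [TopologicalSpace H']
  {I' : ModelWithCorners ℝ E' H'} {M : Type*} [TopologicalSpace M] [ChartedSpace H' M]
  {EN HN : Type*} [NormedAddCommGroup EN] [NormedSpace ℝ EN] [TopologicalSpace HN]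
  {J : ModelWithCorners ℝ EN HN} {N : Type*} [TopologicalSpace N] [ChartedSpace HN N]
  {V : Type*} [NormedAddCommGroup V] [NormedSpace ℝ V]

lemma tb_mk_eq {x y : G} (h : x = y) (v : E) :
    (⟨x, v⟩ : TangentBundle I G) = ⟨y, v⟩ := by subst h; rfl

lemma smooth_one_iff (w : N → LieAlg I G) :
    ContMDiff J I.tangent ∞ (fun p => (⟨1, w p⟩ : TangentBundle I G)) ↔
      ContMDiff J 𝓘(ℝ, LieAlg I G) ∞ w := by
  have key (q : N) : (trivializationAt E (TangentSpace I) (1 : G)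
      (⟨1, w q⟩ : TangentBundle I G)).2 = w q := by
    rw [TangentBundle.trivializationAt_apply]
    exact tangentCoordChange_self (I := I) (x := (1 : G)) (z := 1) (by simp)
  constructor
  · intro h p
    exact (Bundle.contMDiffAt_totalSpace.1 (h p)).2.congr_of_eventuallyEq
      (Eventually.of_forall fun q => (key q).symm)
  · intro h p
    exact Bundle.contMDiffAt_totalSpace.2 ⟨contMDiffAt_const,
      ContMDiffAt.congr_of_eventuallyEq (h p) (Eventually.of_forall key)⟩

lemma smooth_vec_iff (f : N → V) (w : N → V) (hf : ContMDiff J 𝓘(ℝ, V) ∞ f) :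
    ContMDiff J 𝓘(ℝ, V).tangent ∞ (fun p => (⟨f p, w p⟩ : TangentBundle 𝓘(ℝ, V) V)) ↔
      ContMDiff J 𝓘(ℝ, V) ∞ w := by
  have key (p q : N) : (trivializationAt V (TangentSpace 𝓘(ℝ, V))
      (⟨f p, w p⟩ : TangentBundle 𝓘(ℝ, V) V).proj (⟨f q, w q⟩ : TangentBundle 𝓘(ℝ, V) V)).2 =
      w q := by
    rw [TangentBundle.trivializationAt_apply]
    simp [chartAt_self_eq]
  constructor
  · intro h p
    have := (Bundle.contMDiffAt_totalSpace.1 (h p)).2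
    simp only [key] at this
    exact this
  · intro h p
    refine Bundle.contMDiffAt_totalSpace.2 ⟨hf p, ?_⟩
    simp only [key]
    exact h p


variable [IsManifold J ∞ N]

lemma smooth_rightField (g : N → G) (hg : ContMDiff J I ∞ g) (w : N → LieAlg I G)
    (hw : ContMDiff J 𝓘(ℝ, LieAlg I G) ∞ w) :
    ContMDiff J I.tangent ∞ (fun p => (⟨g p, rightField I (g p) (w p)⟩ : TangentBundle I G)) := by
  have h := partial_smooth I (J := J) (I' := I) (fun q : G × N => q.1 * g q.2)
    (contMDiff_fst.mul (hg.comp contMDiff_snd)) _ ((smooth_one_iff I w).2 hw)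
  exact h.congr fun p => tb_mk_eq I (one_mul (g p)).symm _

lemma smooth_thetaR (s : N → TangentBundle I G) (hs : ContMDiff J I.tangent ∞ s) :
    ContMDiff J 𝓘(ℝ, LieAlg I G) ∞ (fun p => thetaR I (s p).1 (s p).2) := by
  have hg : ContMDiff J I ∞ (fun p => (s p).1) := (Bundle.contMDiff_proj _).comp hs
  have h := partial_smooth I (J := J) (I' := I) (fun q : G × N => q.1 * (s q.2).1⁻¹)
    (contMDiff_fst.mul (hg.inv.comp contMDiff_snd)) s hs
  rw [← smooth_one_iff]
  exact h.congr fun p => tb_mk_eq I (mul_inv_cancel (s p).1).symm _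

lemma smooth_thetaL (s : N → TangentBundle I G) (hs : ContMDiff J I.tangent ∞ s) :
    ContMDiff J 𝓘(ℝ, LieAlg I G) ∞ (fun p => thetaL I (s p).1 (s p).2) := by
  have hg : ContMDiff J I ∞ (fun p => (s p).1) := (Bundle.contMDiff_proj _).comp hs
  have h := partial_smooth I (J := J) (I' := I) (fun q : G × N => (s q.2).1⁻¹ * q.1)
    ((hg.inv.comp contMDiff_snd).mul contMDiff_fst) s hs
  rw [← smooth_one_iff]
  exact h.congr fun p => tb_mk_eq I (inv_mul_cancel (s p).1).symm _

lemma smooth_Ad (g : N → G) (hg : ContMDiff J I ∞ g) (w : N → LieAlg I G)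
    (hw : ContMDiff J 𝓘(ℝ, LieAlg I G) ∞ w) :
    ContMDiff J 𝓘(ℝ, LieAlg I G) ∞ (fun p => Ad I (g p) (w p)) := by
  have hg' : ContMDiff (I.prod J) I ∞ (fun q : G × N => g q.2) := hg.comp contMDiff_snd
  have h := partial_smooth I (J := J) (I' := I) (fun q : G × N => g q.2 * q.1 * (g q.2)⁻¹)
    ((hg'.mul contMDiff_fst).mul hg'.inv) _ ((smooth_one_iff I w).2 hw)
  rw [← smooth_one_iff]
  exact h.congr fun p => tb_mk_eq I (by simp) _

lemma smooth_deriv (ζ : G × N → V) (hζ : ContMDiff (I.prod J) 𝓘(ℝ, V) ∞ ζ)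
    (s : N → TangentBundle I G) (hs : ContMDiff J I.tangent ∞ s) :
    ContMDiff J 𝓘(ℝ, V) ∞ (fun p => mvfderiv I (fun h => ζ (h, p)) (s p).1 (s p).2) := by
  have hg : ContMDiff J I ∞ (fun p => (s p).1) := (Bundle.contMDiff_proj _).comp hs
  have h := partial_smooth I (J := J) (I' := 𝓘(ℝ, V)) ζ hζ s hs
  exact (smooth_vec_iff _ _ (hζ.comp (hg.prodMk contMDiff_id))).1 h

end Smooth

section ParamInt
open MeasureTheory
lemma contDiffOn_integral {U : Set E} (hU : IsOpen U) (F : E × ℝ → ℝ)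
    (hF : ContDiffOn ℝ ∞ F (U ×ˢ univ)) :
    ContDiffOn ℝ ∞ (fun x => ∫ t in (0 : ℝ)..1, F (x, t)) U := by
  let χ : ContDiffBump (0 : ℝ) := ⟨2, 3, by norm_num, by norm_num⟩
  have key := contDiffOn_convolution_right_with_param_comp (𝕜 := ℝ) (n := ⊤)
    (ContinuousLinearMap.mul ℝ ℝ) (s := U) (v := fun _ : E => (0 : ℝ)) contDiffOn_const
    (f := (Set.Ioc (0 : ℝ) 1).indicator (fun _ => (1 : ℝ)))
    (g := fun x t => χ t * F (x, -t)) (k := Metric.closedBall 0 3) (μ := volume) hU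
    (isCompact_closedBall _ _) (fun p x _ hx => by
      rw [χ.zero_of_le_dist (by
        have : (3 : ℝ) < dist x 0 := not_le.1 hx
        exact this.le), zero_mul])
    (IntegrableOn.integrable_indicator (by simp) measurableSet_Ioc).locallyIntegrable
    (by
      refine ContDiffOn.mul (χ.contDiff.comp contDiff_snd).contDiffOn ?_
      exact hF.comp (g := F) (f := fun q : E × ℝ => (q.1, -q.2))
        (contDiff_fst.prodMk contDiff_snd.neg).contDiffOn (fun q hq => ⟨hq.1, trivial⟩))
  refine ContDiffOn.congr key fun x _ => ?_
  rw [intervalIntegral.integral_of_le zero_le_one, ← integral_indicator measurableSet_Ioc]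
  refine integral_congr_ae (Eventually.of_forall fun t => ?_)
  by_cases ht : t ∈ Ioc (0 : ℝ) 1
  · have : χ (0 - t) = 1 := χ.one_of_mem_closedBall (by
      simp only [zero_sub, Metric.mem_closedBall, dist_zero_right, norm_neg]
      rw [Real.norm_eq_abs, abs_of_pos ht.1]
      exact ht.2.trans one_le_two)
    simp only [indicator_of_mem ht, ContinuousLinearMap.mul_apply', this]
    simp
  · simp [indicator_of_notMem ht]

lemma smooth_integral (f : G × ℝ → ℝ)
    (hf : ContMDiff (I.prod 𝓘(ℝ, ℝ)) 𝓘(ℝ, ℝ) ∞ f) :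
    ContMDiff I 𝓘(ℝ, ℝ) ∞ (fun g => ∫ t in (0 : ℝ)..1, f (g, t)) := by
  intro x
  have h1 : ContDiffOn ℝ ∞ (fun q : E × ℝ => f ((extChartAt I x).symm q.1, q.2))
      ((extChartAt I x).target ×ˢ univ) := by
    rw [← contMDiffOn_iff_contDiffOn]
    refine hf.comp_contMDiffOn ?_
    refine ContMDiffOn.prodMk ?_ contDiff_snd.contMDiff.contMDiffOn
    exact (contMDiffOn_extChartAt_symm x).comp contDiff_fst.contMDiff.contMDiffOn
      (fun q hq => hq.1)
  have h2 := contDiffOn_integral (isOpen_extChartAt_target (I := I) x) _ h1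
  have h3 := (contMDiffOn_iff_contDiffOn.2 h2).comp (contMDiffOn_extChartAt (I := I) (x := x))
    (fun y hy => (extChartAt I x).map_source (by simpa using hy))
  refine (h3.contMDiffAt ((chartAt H x).open_source.mem_nhds (mem_chart_source H x))).congr_of_eventuallyEq ?_
  filter_upwards [(chartAt H x).open_source.mem_nhds (mem_chart_source H x)] with y hy
  simp only [Function.comp_apply]
  rw [(extChartAt I x).left_inv (by simpa using hy)]
end ParamInt

section LieStructure
variable [FiniteDimensional ℝ E]

instance instLieRing : LieRing (LieAlg I G) :=
  haveI : CompleteSpace E := FiniteDimensional.complete ℝ E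
  haveI : LieGroup I (minSmoothness ℝ 3) G := by
    rw [minSmoothness_of_isRCLikeNormedField]; infer_instance
  { add_lie := add_lie (L := GroupLieAlgebra I G) (M := GroupLieAlgebra I G)
    lie_add := lie_add (L := GroupLieAlgebra I G) (M := GroupLieAlgebra I G)
    lie_self := lie_self (L := GroupLieAlgebra I G)
    leibniz_lie := leibniz_lie (L₁ := GroupLieAlgebra I G) (L₂ := GroupLieAlgebra I G) (M := GroupLieAlgebra I G) }

instance instLieAlgebra : LieAlgebra ℝ (LieAlg I G) :=
  haveI : CompleteSpace E := FiniteDimensional.complete ℝ E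
  haveI : LieGroup I (minSmoothness ℝ 3) G := by
    rw [minSmoothness_of_isRCLikeNormedField]; infer_instance
  { lie_smul := lie_smul (R := ℝ) (L := GroupLieAlgebra I G) (M := GroupLieAlgebra I G) }

variable (G) in
/-- The Lie bracket as a continuous bilinear map. -/
def lieCLM : LieAlg I G →L[ℝ] LieAlg I G →L[ℝ] LieAlg I G :=
  LinearMap.toContinuousLinearMap
    ((LinearMap.toContinuousLinearMap (E := LieAlg I G) (F' := LieAlg I G)).toLinearMap ∘ₗ
      (LinearMap.mk₂ ℝ (fun x y : LieAlg I G => ⁅x, y⁆) (fun x y z => add_lie x y z)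
        (fun c x y => smul_lie c x y) (fun x y z => lie_add x y z)
        (fun c x y => lie_smul c x y)))

lemma lieCLM_apply (x y : LieAlg I G) : lieCLM I G x y = ⁅x, y⁆ := rfl
end LieStructure

/-! shortcut instances -/
instance : AddCommGroup (LieAlg I G) := NormedAddCommGroup.toAddCommGroup
instance : AddCommMonoid (LieAlg I G) := AddCommGroup.toAddCommMonoid
instance : AddMonoid (LieAlg I G) := AddCommMonoid.toAddMonoid
instance : Zero (LieAlg I G) := AddMonoid.toZero
instance : Module ℝ (LieAlg I G) := NormedSpace.toModule
instance : SMulZeroClass ℝ (LieAlg I G) := Module.toDistribMulAction.toDistribSMul.toSMulZeroClass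
instance : SMul ℝ (LieAlg I G) := SMulZeroClass.toSMul

section GroupLemmas

lemma thetaR_rightField (g : G) (w : LieAlg I G) : thetaR I g (rightField I g w) = w := by
  have h1 : MDifferentiableAt I I (fun h : G => h * g) 1 :=
    (mul_right_smooth I g).mdifferentiableAt (by simp)
  have h2 : MDifferentiableAt I I (fun h : G => h * g⁻¹) g :=
    (mul_right_smooth I g⁻¹).mdifferentiableAt (by simp)
  have h3 := mfderiv_comp_apply_of_eq (x := (1 : G)) (y := g) h2 h1 (by simp) w
  have h4 : (fun h : G => h * g⁻¹) ∘ (fun h : G => h * g) = id := by ext; simp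
  rw [h4] at h3
  exact h3.symm.trans (congrArg (fun T : E →L[ℝ] E => T w) (mfderiv_id (I := I) (x := (1 : G))))

/-- Chain rule for a vector-valued function after a map between manifolds. -/
lemma mvfderiv_comp_vec {V : Type*} [NormedAddCommGroup V] [NormedSpace ℝ V]
    {E' H' : Type*} [NormedAddCommGroup E'] [NormedSpace ℝ E'] [TopologicalSpace H']
    {I' : ModelWithCorners ℝ E' H'} {M : Type*} [TopologicalSpace M] [ChartedSpace H' M]
    (f : G → V) (φ : M → G) (x : M) (y : G) (hf : MDifferentiableAt I 𝓘(ℝ, V) f y)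
    (hφ : MDifferentiableAt I' I φ x) (h : φ x = y) (v : TangentSpace I' x) :
    mvfderiv I' (fun z => f (φ z)) x v = mvfderiv I f (φ x) (mfderiv I' I φ x v) := by
  subst h
  exact mfderiv_comp_apply x hf hφ v

/-- A continuous linear map commutes with differentiation. -/
lemma mvfderiv_clm {V W : Type*} [NormedAddCommGroup V] [NormedSpace ℝ V]
    [NormedAddCommGroup W] [NormedSpace ℝ W] (T : V →L[ℝ] W)
    (f : G → V) (x : G) (hf : MDifferentiableAt I 𝓘(ℝ, V) f x) (v : TangentSpace I x) :
    mvfderiv I (fun z => T (f z)) x v = T (mvfderiv I f x v) := by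
  have h := mfderiv_comp_apply x (I' := 𝓘(ℝ, V)) (I'' := 𝓘(ℝ, W)) (g := T) (f := f)
    T.mdifferentiableAt hf v
  rw [T.mfderiv_eq] at h
  exact h

lemma smooth_Ad_const (w : LieAlg I G) :
    ContMDiff I 𝓘(ℝ, LieAlg I G) ∞ (fun h : G => Ad I h w) :=
  smooth_Ad I (J := I) id contMDiff_id _ contMDiff_const

lemma mvfderiv_Ad (v w : LieAlg I G) :
    mvfderiv I (fun h : G => Ad I h w) 1 v = ⁅v, w⁆ :=
  mfderiv_Ad I v w ((smooth_Ad_const I w).mdifferentiableAt (by simp))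

lemma Ad_lie (g : G) (x y : LieAlg I G) : Ad I g ⁅x, y⁆ = ⁅Ad I g x, Ad I g y⁆ := by
  rw [← mvfderiv_Ad, ← mvfderiv_Ad]
  have hs (w : LieAlg I G) (a : G) : MDifferentiableAt I 𝓘(ℝ, LieAlg I G) (fun h : G => Ad I h w) a :=
    (smooth_Ad_const I w).mdifferentiableAt (by simp)
  have h1 := mvfderiv_clm I (Ad I g) (fun h : G => Ad I h y) 1 (hs y 1) x
  have hc : MDifferentiableAt I I (fun h : G => g * h * g⁻¹) 1 :=
    ((mul_right_smooth I g⁻¹).comp (mul_left_smooth I g)).mdifferentiableAt (by simp)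
  have h2 := mvfderiv_comp_vec I (fun h : G => Ad I h (Ad I g y)) (fun h : G => g * h * g⁻¹) 1 1
    (hs _ _) hc (by simp) x
  have h3 : (fun h : G => Ad I (g * h * g⁻¹) (Ad I g y)) = fun h => Ad I g (Ad I h y) := by
    ext h; rw [← Ad_mul, ← Ad_mul]; congr 2; group
  rw [h3] at h2
  refine h1.symm.trans (h2.trans ?_)
  have : g * 1 * g⁻¹ = 1 := by simp
  rw [this]
  rfl

/-- Derivative of `h ↦ Ad_h (f h)` along a right-invariant direction. -/
lemma mvfderiv_Ad_fun (f : G → LieAlg I G) (hf : ContMDiff I 𝓘(ℝ, LieAlg I G) ∞ f) (g : G)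
    (v : LieAlg I G) :
    mvfderiv I (fun h => Ad I h (f h)) g (rightField I g v) =
      ⁅v, Ad I g (f g)⁆ + Ad I g (mvfderiv I f g (rightField I g v)) := by
  have hF : ContMDiff (I.prod I) 𝓘(ℝ, LieAlg I G) ∞ (fun p : G × G => Ad I p.1 (f p.2)) :=
    smooth_Ad I (J := I.prod I) _ contMDiff_fst _ (hf.comp contMDiff_snd)
  have hF' := hF.mdifferentiableAt (x := (g, g)) (by simp)
  have hδ : MDifferentiableAt I (I.prod I) (fun h : G => (h, h)) g :=
    (contMDiff_id.prodMk contMDiff_id : ContMDiff I (I.prod I) ∞ (fun h : G => (h, h))).mdifferentiableAt (by simp)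
  have h1 := mfderiv_comp_apply g (I' := I.prod I) (g := fun p : G × G => Ad I p.1 (f p.2))
    (f := fun h : G => (h, h)) hF' hδ (rightField I g v)
  have h2 := mfderiv_prod_eq_add_apply (v := mfderiv I (I.prod I) (fun h : G => (h, h)) g (rightField I g v)) hF'
  have h3 : mfderiv I (I.prod I) (fun h : G => (h, h)) g (rightField I g v) =
      ((rightField I g v : E), (rightField I g v : E)) := by
    have := mdifferentiableAt_id.mfderiv_prod (x := g) (I := I) (mdifferentiableAt_id (I := I) (x := g))
    exact (congrArg (fun T : E →L[ℝ] E × E => T (rightField I g v)) this).trans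
      (by rw [mfderiv_id]; rfl)
  have h4 : mvfderiv I (fun h : G => Ad I h (f g)) g (rightField I g v) = ⁅v, Ad I g (f g)⁆ := by
    have k1 : MDifferentiableAt I I (fun h : G => h * g) 1 :=
      (mul_right_smooth I g).mdifferentiableAt (by simp)
    have k2 := mvfderiv_comp_vec I (fun h : G => Ad I h (f g)) (fun h : G => h * g) 1 g
      ((smooth_Ad_const I _).mdifferentiableAt (by simp)) k1 (by simp) v
    have k3 : (fun h : G => Ad I (h * g) (f g)) = fun h => Ad I h (Ad I g (f g)) := by
      ext h; rw [← Ad_mul]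
    rw [k3, mvfderiv_Ad, one_mul] at k2
    exact k2.symm
  have h5 := mvfderiv_clm I (Ad I g) f g (hf.mdifferentiableAt (by simp)) (rightField I g v)
  rw [← h4, ← h5]
  refine h1.trans (h2.trans ?_)
  rw [h3]
  rfl
end GroupLemmas

section Modules
variable (G)

/-- `C^∞(G)`. -/
abbrev Fn := ContMDiffMap I 𝓘(ℝ, ℝ) G ℝ ∞

/-- `C^∞(G, 𝔤)`. -/
abbrev LieFn := ContMDiffMap I 𝓘(ℝ, LieAlg I G) G (LieAlg I G) ∞

/-- `C^∞(G × ℝ, 𝔤)`. -/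
abbrev LiePath :=
  ContMDiffMap (I.prod 𝓘(ℝ, ℝ)) 𝓘(ℝ, LieAlg I G) (G × ℝ) (LieAlg I G) ∞

/-- Smooth vector fields on `G`. -/
abbrev VF := ContMDiffSection I E ∞ (fun g : G => TangentSpace I g)

variable {G}

instance : SMul (Fn I G) (LiePath I G) :=
  ⟨fun f x => ⟨fun p => f p.1 • x p, (f.contMDiff.comp contMDiff_fst).smul x.contMDiff⟩⟩

lemma path_smul_apply (f : Fn I G) (x : LiePath I G) (p : G × ℝ) : (f • x) p = f p.1 • x p := rfl

instance : Module (Fn I G) (LiePath I G) where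
  one_smul x := by ext p; exact one_smul ℝ (x p)
  mul_smul f g x := by ext p; exact mul_smul (f p.1) (g p.1) (x p)
  smul_zero f := by ext p; exact smul_zero (f p.1)
  smul_add f x y := by ext p; exact smul_add (f p.1) (x p) (y p)
  add_smul f g x := by ext p; exact add_smul (f p.1) (g p.1) (x p)
  zero_smul x := by ext p; exact zero_smul ℝ (x p)

instance : IsScalarTower ℝ (Fn I G) (LiePath I G) :=
  ⟨fun c f x => by ext p; exact mul_smul c (f p.1) (x p)⟩

instance : SMulCommClass ℝ (Fn I G) (LiePath I G) :=
  ⟨fun c f x => by ext p; exact smul_comm c (f p.1) (x p)⟩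

instance : SMul (Fn I G) (VF I G) :=
  ⟨fun f X => ⟨fun g => f g • X g, f.contMDiff.smul_section X.contMDiff⟩⟩

lemma vf_smul_apply (f : Fn I G) (X : VF I G) (g : G) : (f • X) g = f g • X g := rfl

instance : Module (Fn I G) (VF I G) where
  one_smul X := by ext g; exact one_smul ℝ (X g)
  mul_smul f f' X := by ext g; exact mul_smul (f g) (f' g) (X g)
  smul_zero f := by ext g; exact smul_zero (A := TangentSpace I g) (f g)
  smul_add f X Y := by ext g; exact smul_add (f g) (X g) (Y g)
  add_smul f f' X := by ext g; exact add_smul (f g) (f' g) (X g)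
  zero_smul X := by ext g; exact zero_smul ℝ (X g)

lemma fn_smul_apply (f : Fn I G) (x : LieFn I G) (g : G) : (f • x) g = f g • x g := rfl

/-- The value of a path at a fixed time. -/
def evalAt (t : ℝ) : LiePath I G →ₗ[Fn I G] LieFn I G where
  toFun x := ⟨fun g => x (g, t), x.contMDiff.comp (contMDiff_id.prodMk contMDiff_const)⟩
  map_add' _ _ := rfl
  map_smul' _ _ := rfl

lemma evalAt_apply (t : ℝ) (x : LiePath I G) (g : G) : evalAt I t x g = x (g, t) := rfl

/-- `v ↦ Ad_g (v g)` -/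
def AdFn : LieFn I G →ₗ[Fn I G] LieFn I G where
  toFun v := ⟨fun g => Ad I g (v g), smooth_Ad I (J := I) (fun g => g) contMDiff_id v v.contMDiff⟩
  map_add' v w := by ext g; exact map_add (Ad I g) _ _
  map_smul' f v := by ext g; exact map_smul (Ad I g) (f g) _

lemma AdFn_apply (v : LieFn I G) (g : G) : AdFn I v g = Ad I g (v g) := rfl

/-- The Maurer--Cartan form `θ^L`, as a `C^∞(G)`-linear map on vector fields. -/
def thetaLForm : VF I G →ₗ[Fn I G] LieFn I G where
  toFun X := ⟨fun g => thetaL I g (X g), smooth_thetaL I (J := I) (fun g => ⟨g, X g⟩) X.contMDiff⟩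
  map_add' v w := by ext g; exact map_add (thetaL I g) _ _
  map_smul' f v := by ext g; exact map_smul (thetaL I g) (f g) _

/-- The Maurer--Cartan form `θ^R`. -/
def thetaRForm : VF I G →ₗ[Fn I G] LieFn I G where
  toFun X := ⟨fun g => thetaR I g (X g), smooth_thetaR I (J := I) (fun g => ⟨g, X g⟩) X.contMDiff⟩
  map_add' v w := by ext g; exact map_add (thetaR I g) _ _
  map_smul' f v := by ext g; exact map_smul (thetaR I g) (f g) _

/-- The vector field `X` with `θ^R(X) = v`. -/
def rightVF : LieFn I G →ₗ[Fn I G] VF I G where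
  toFun v := ⟨fun g => rightField I g (v g),
    smooth_rightField I (J := I) (fun g => g) contMDiff_id v v.contMDiff⟩
  map_add' v w := by ext g; exact map_add (rightField I g) _ _
  map_smul' f v := by ext g; exact map_smul (rightField I g) (f g) _

lemma rightVF_apply (v : LieFn I G) (g : G) : rightVF I v g = rightField I g (v g) := rfl

lemma thetaRForm_rightVF (v : LieFn I G) : thetaRForm I (rightVF I v) = v := by
  ext g; exact thetaR_rightField I g (v g)

/-- The function `v_ξ = ξ(·, 1) - Ad ξ(·, 0)`. -/
def twist : LiePath I G →ₗ[Fn I G] LieFn I G := evalAt I 1 - AdFn I ∘ₗ evalAt I 0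

lemma twist_apply (x : LiePath I G) (g : G) : twist I x g = x (g, 1) - Ad I g (x (g, 0)) := rfl

variable (G) in
/-- The sections of the Atiyah algebroid `A` of the path fibration: functions
`ξ : G × ℝ → 𝔤` such that `ξ(g, t + 1) = Ad_g ξ(g, t) + v(g)` for some smooth `v`. -/
def secA : Submodule (Fn I G) (LiePath I G) where
  carrier := {x | ∃ v : LieFn I G, ∀ g t, x (g, t + 1) = Ad I g (x (g, t)) + v g}
  add_mem' := by
    rintro x y ⟨v, hv⟩ ⟨w, hw⟩
    refine ⟨v + w, fun g t => ?_⟩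
    have h1 : (x + y) (g, t + 1) = x (g, t + 1) + y (g, t + 1) := rfl
    have h2 : (x + y) (g, t) = x (g, t) + y (g, t) := rfl
    have h3 : (v + w) g = v g + w g := rfl
    rw [h1, h2, h3, hv, hw, map_add]; abel
  zero_mem' := ⟨0, fun g _ => ((add_zero _).trans (map_zero (Ad I g))).symm⟩
  smul_mem' := by
    rintro f x ⟨v, hv⟩
    refine ⟨f • v, fun g t => ?_⟩
    rw [path_smul_apply, path_smul_apply, fn_smul_apply, hv, map_smul, smul_add]

lemma twist_eq {x : LiePath I G} {v : LieFn I G}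
    (h : ∀ g t, x (g, t + 1) = Ad I g (x (g, t)) + v g) : twist I x = v := by
  ext g
  have := h g 0
  rw [zero_add] at this
  rw [twist_apply, this, add_sub_cancel_left]

lemma secA_periodic {x : LiePath I G} (hx : x ∈ secA I G) (g : G) (t : ℝ) :
    x (g, t + 1) = Ad I g (x (g, t)) + twist I x g := by
  obtain ⟨v, hv⟩ := hx
  rw [twist_eq I hv, hv]

variable (G) in
/-- The anchor `a : Γ(A) → 𝔛(G)`, determined by `θ^R(a(ξ)) = v_ξ`. -/
def anchor : secA I G →ₗ[Fn I G] VF I G := rightVF I ∘ₗ twist I ∘ₗ (secA I G).subtype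

lemma thetaR_anchor (x : secA I G) (v : LieFn I G)
    (h : ∀ g t, (x : LiePath I G) (g, t + 1) = Ad I g ((x : LiePath I G) (g, t)) + v g) :
    thetaRForm I (anchor I G x) = v := by
  refine (thetaRForm_rightVF I _).trans (twist_eq I h)

end Modules

section Algebra
variable {R Γ V W U : Type*} [CommRing R] [AddCommGroup Γ] [Module R Γ] [AddCommGroup V] [Module R V]
  [AddCommGroup W] [Module R W] [AddCommGroup U] [Module R U]

/-- An alternating bilinear map from a function of two variables. -/
def mkAlt2 (f : Γ → Γ → V) (add : ∀ x y z, f (x + y) z = f x z + f y z)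
    (smul : ∀ (c : R) x z, f (c • x) z = c • f x z) (skew : ∀ x y, f y x = -f x y)
    (self : ∀ x, f x x = 0) : Γ [⋀^Fin 2]→ₗ[R] V where
  toFun v := f (v 0) (v 1)
  map_update_add' v i x y := by
    have e : ∀ x y z, f z (x + y) = f z x + f z y := fun x y z => by
      rw [skew, add, neg_add, ← skew, ← skew]
    fin_cases i <;> simp [add, e]
  map_update_smul' v i c x := by
    have e : ∀ x z, f z (c • x) = c • f z x := fun x z => by
      rw [skew, smul, ← smul_neg, ← skew]
    fin_cases i <;> simp [smul, e]
  map_eq_zero_of_eq' v i j h hij := by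
    fin_cases i <;> fin_cases j <;> simp at hij h <;> simp [h, self]

lemma fin3_ne : (1 : Fin 3) ≠ 0 ∧ (2 : Fin 3) ≠ 0 ∧ (2 : Fin 3) ≠ 1 := by decide

/-- An alternating trilinear map from a function of three variables. -/
def mkAlt3 (f : Γ → Γ → Γ → V) (add : ∀ x y z w, f (x + y) z w = f x z w + f y z w)
    (smul : ∀ (c : R) x z w, f (c • x) z w = c • f x z w)
    (skew : ∀ x y z, f y x z = -f x y z) (skew' : ∀ x y z, f x z y = -f x y z)
    (self : ∀ x z, f x x z = 0) : Γ [⋀^Fin 3]→ₗ[R] V where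
  toFun v := f (v 0) (v 1) (v 2)
  map_update_add' v i x y := by
    have e : ∀ x y z w, f z (x + y) w = f z x w + f z y w := fun x y z w => by
      rw [skew, add, neg_add, ← skew, ← skew]
    have e' : ∀ x y z w, f z w (x + y) = f z w x + f z w y := fun x y z w => by
      rw [skew', e, neg_add, ← skew', ← skew']
    match i with
    | 0 => simp only [Function.update_self, Function.update_of_ne fin3_ne.1,
        Function.update_of_ne fin3_ne.2.1, add]
    | 1 => simp only [Function.update_self, Function.update_of_ne fin3_ne.1.symm,
        Function.update_of_ne fin3_ne.2.2, e]
    | 2 => simp only [Function.update_self, Function.update_of_ne fin3_ne.2.1.symm,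
        Function.update_of_ne fin3_ne.2.2.symm, e']
  map_update_smul' v i c x := by
    have e : ∀ x z w, f z (c • x) w = c • f z x w := fun x z w => by
      rw [skew, smul, ← smul_neg, ← skew]
    have e' : ∀ x z w, f z w (c • x) = c • f z w x := fun x z w => by
      rw [skew', e, ← smul_neg, ← skew']
    match i with
    | 0 => simp only [Function.update_self, Function.update_of_ne fin3_ne.1,
        Function.update_of_ne fin3_ne.2.1, smul]
    | 1 => simp only [Function.update_self, Function.update_of_ne fin3_ne.1.symm,
        Function.update_of_ne fin3_ne.2.2, e]
    | 2 => simp only [Function.update_self, Function.update_of_ne fin3_ne.2.1.symm,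
        Function.update_of_ne fin3_ne.2.2.symm, e']
  map_eq_zero_of_eq' v i j h hij := by
    have e : ∀ x z, f z x x = 0 := fun x z => by rw [skew, skew', self]; simp
    have e' : ∀ x z, f x z x = 0 := fun x z => by rw [skew', self, neg_zero]
    match i, j with
    | 0, 0 | 1, 1 | 2, 2 => exact absurd rfl hij
    | 0, 1 => simp only [h, self]
    | 1, 0 => simp only [h, self]
    | 0, 2 => simp only [h, e']
    | 2, 0 => simp only [h, e']
    | 1, 2 => simp only [h, e]
    | 2, 1 => simp only [h, e]

/-- The product `(φ · ψ)(x, y) = ⟨φ x, ψ y⟩ - ⟨φ y, ψ x⟩` of two `1`-forms. -/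
def wedge11 (p : U →ₗ[R] W →ₗ[R] V) (φ : Γ →ₗ[R] U) (ψ : Γ →ₗ[R] W) : Γ [⋀^Fin 2]→ₗ[R] V :=
  mkAlt2 (fun x y => p (φ x) (ψ y) - p (φ y) (ψ x)) (fun x y z => by simp; abel)
    (fun c x z => by simp [smul_sub]) (fun x y => by simp) (fun x => by simp)

lemma alt2_skew (om : Γ [⋀^Fin 2]→ₗ[R] V) (x y : Γ) : om ![y, x] = -om ![x, y] := by
  have := om.map_swap ![x, y] (i := 0) (j := 1) (by simp)
  rw [← this]
  congr 1
  ext i; fin_cases i <;> simp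

lemma alt2_self (om : Γ [⋀^Fin 2]→ₗ[R] V) (x : Γ) : om ![x, x] = 0 :=
  om.map_eq_zero_of_eq ![x, x] (i := 0) (j := 1) rfl (by simp)

lemma alt2_add (om : Γ [⋀^Fin 2]→ₗ[R] V) (x y z : Γ) :
    om ![x + y, z] = om ![x, z] + om ![y, z] := by
  have h (u : Γ) : Function.update ![x, z] 0 u = ![u, z] := by
    ext i
    match i with
    | 0 => exact Function.update_self ..
    | 1 => exact Function.update_of_ne (by decide) ..
  rw [← h, om.map_update_add, h, h]

lemma alt2_smul (om : Γ [⋀^Fin 2]→ₗ[R] V) (c : R) (x z : Γ) :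
    om ![c • x, z] = c • om ![x, z] := by
  have h (u : Γ) : Function.update ![x, z] 0 u = ![u, z] := by
    ext i
    match i with
    | 0 => exact Function.update_self ..
    | 1 => exact Function.update_of_ne (by decide) ..
  rw [← h, om.map_update_smul, h]

lemma alt2_add' (om : Γ [⋀^Fin 2]→ₗ[R] V) (x y z : Γ) :
    om ![z, x + y] = om ![z, x] + om ![z, y] := by
  rw [alt2_skew, alt2_add, neg_add, ← alt2_skew, ← alt2_skew]

lemma alt2_smul' (om : Γ [⋀^Fin 2]→ₗ[R] V) (c : R) (x z : Γ) :
    om ![z, c • x] = c • om ![z, x] := by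
  rw [alt2_skew, alt2_smul, ← smul_neg, ← alt2_skew]

/-- The product of a `1`-form and a `2`-form. -/
def wedge12 (p : U →ₗ[R] W →ₗ[R] V) (φ : Γ →ₗ[R] U) (ψ : Γ [⋀^Fin 2]→ₗ[R] W) :
    Γ [⋀^Fin 3]→ₗ[R] V :=
  mkAlt3 (fun x y z => p (φ x) (ψ ![y, z]) - p (φ y) (ψ ![x, z]) + p (φ z) (ψ ![x, y]))
    (fun x y z w => by simp only [map_add, LinearMap.add_apply, alt2_add]; abel)
    (fun c x z w => by
      simp only [map_smul, LinearMap.smul_apply, alt2_smul, smul_sub, smul_add])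
    (fun x y z => by rw [alt2_skew ψ x y, map_neg]; abel)
    (fun x y z => by rw [alt2_skew ψ y z, map_neg]; abel)
    (fun x z => by rw [alt2_self]; simp)

/-- Contraction of a `2`-form. -/
def contract (x : Γ) (om : Γ [⋀^Fin 2]→ₗ[R] V) : Γ →ₗ[R] V where
  toFun y := om ![x, y]
  map_add' y z := alt2_add' om y z x
  map_smul' c y := alt2_smul' om c y x

variable [Algebra ℝ R]

variable (R Γ) in
/-- The anchor and the bracket on the sections of a Lie algebroid over the ring of functions
`R`, with the laws needed for the differential. -/
structure AlgebroidData where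
  /-- the anchor, acting on functions -/
  act : Γ →ₗ[R] Derivation ℝ R R
  /-- the bracket -/
  br : Γ → Γ → Γ
  add_br : ∀ x y z, br (x + y) z = br x z + br y z
  br_skew : ∀ x y, br y x = -br x y
  br_self : ∀ x, br x x = 0
  br_smul : ∀ x (f : R) y, br x (f • y) = f • br x y + act x f • y

/-- A connection on an `R`-module. -/
structure AlgebroidData.Conn (L : AlgebroidData R Γ) (V : Type*) [AddCommGroup V] [Module R V] where
  /-- the covariant derivative -/
  nabla : Γ →ₗ[R] V →+ V
  leib : ∀ x (f : R) v, nabla x (f • v) = f • nabla x v + L.act x f • v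

variable {L : AlgebroidData R Γ}

lemma AlgebroidData.smul_br (L : AlgebroidData R Γ) (f : R) (x y : Γ) :
    L.br (f • x) y = f • L.br x y - L.act y f • x := by
  rw [L.br_skew y, L.br_smul, L.br_skew x y, smul_neg]; abel

/-- The trivial connection on functions. -/
def AlgebroidData.trivConn (L : AlgebroidData R Γ) : L.Conn R where
  nabla :=
    { toFun x := ((L.act x : R →ₗ[ℝ] R) : R →+ R)
      map_add' x y := by ext; simp
      map_smul' f x := by ext; simp }
  leib x f v := by simp [mul_comm]

/-- The exterior covariant derivative of a `1`-form. -/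
def d1 (D : L.Conn V) (φ : Γ →ₗ[R] V) : Γ [⋀^Fin 2]→ₗ[R] V :=
  mkAlt2 (fun x y => D.nabla x (φ y) - D.nabla y (φ x) - φ (L.br x y))
    (fun x y z => by simp only [map_add, AddMonoidHom.add_apply, L.add_br]; abel)
    (fun c x z => by
      simp only [map_smul, AddMonoidHom.smul_apply, L.smul_br, D.leib, map_sub, smul_sub]; abel)
    (fun x y => by rw [L.br_skew x y, map_neg]; abel)
    (fun x => by simp [L.br_self])

/-- The exterior covariant derivative of a `2`-form. -/
def d2 (D : L.Conn V) (om : Γ [⋀^Fin 2]→ₗ[R] V) : Γ [⋀^Fin 3]→ₗ[R] V :=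
  mkAlt3 (fun x y z => D.nabla x (om ![y, z]) - D.nabla y (om ![x, z]) + D.nabla z (om ![x, y])
      - om ![L.br x y, z] + om ![L.br x z, y] - om ![L.br y z, x])
    (fun x y z w => by
      simp only [map_add, AddMonoidHom.add_apply, L.add_br, alt2_add, alt2_add']; abel)
    (fun c x z w => by
      simp only [map_smul, AddMonoidHom.smul_apply, L.smul_br, D.leib,
        alt2_smul, alt2_smul', sub_eq_add_neg, alt2_add, smul_add, ← neg_smul]
      simp only [neg_smul, smul_neg]
      abel)
    (fun x y z => by
      rw [alt2_skew om x y, L.br_skew x y, map_neg, ← neg_one_smul R (L.br x y), alt2_smul,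
        neg_one_smul]; abel)
    (fun x y z => by
      rw [alt2_skew om y z, L.br_skew y z, map_neg, ← neg_one_smul R (L.br y z), alt2_smul,
        neg_one_smul]; abel)
    (fun x z => by
      rw [alt2_self, L.br_self, map_zero]
      have : om ![(0 : Γ), z] = 0 := by
        rw [← zero_smul R (0 : Γ), alt2_smul, zero_smul]
      rw [this]; abel)

end Algebra

section Derivatives
variable [FiniteDimensional ℝ E]

/-- The derivative of a function along a vector field. -/
def derFn (X : VF I G) (f : Fn I G) : Fn I G :=
  ⟨fun g => mvfderiv I f g (X g), smooth_deriv I (J := I) (fun q : G × G => f q.1)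
    (f.contMDiff.comp contMDiff_fst) (fun g => ⟨g, X g⟩) X.contMDiff⟩

/-- The derivative of a `𝔤`-valued function along a vector field. -/
def derLie (X : VF I G) (v : LieFn I G) : LieFn I G :=
  ⟨fun g => mvfderiv I v g (X g), smooth_deriv I (J := I) (fun q : G × G => v q.1)
    (v.contMDiff.comp contMDiff_fst) (fun g => ⟨g, X g⟩) X.contMDiff⟩

/-- The derivative of a path along a vector field, at fixed time. -/
def derPath (X : VF I G) (x : LiePath I G) : LiePath I G :=
  ⟨fun p => mvfderiv I (fun h => x (h, p.2)) p.1 (X p.1),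
    smooth_deriv I (J := I.prod 𝓘(ℝ, ℝ)) (fun q : G × (G × ℝ) => x (q.1, q.2.2))
    (x.contMDiff.comp (contMDiff_fst.prodMk (contMDiff_snd.comp contMDiff_snd)))
    (fun p => ⟨p.1, X p.1⟩)
    (X.contMDiff.comp contMDiff_fst)⟩

lemma derFn_apply (X : VF I G) (f : Fn I G) (g : G) : derFn I X f g = mvfderiv I f g (X g) := rfl
lemma derLie_apply (X : VF I G) (f : LieFn I G) (g : G) :
    derLie I X f g = mvfderiv I f g (X g) := rfl
lemma derPath_apply (X : VF I G) (x : LiePath I G) (g : G) (t : ℝ) :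
    derPath I X x (g, t) = mvfderiv I (evalAt I t x) g (X g) := rfl

lemma fn_md (f : Fn I G) (g : G) : MDifferentiableAt I 𝓘(ℝ, ℝ) f g :=
  f.contMDiff.mdifferentiableAt (by simp)
lemma lieFn_md (f : LieFn I G) (g : G) : MDifferentiableAt I 𝓘(ℝ, LieAlg I G) f g :=
  f.contMDiff.mdifferentiableAt (by simp)

lemma derLie_add (X : VF I G) (v w : LieFn I G) : derLie I X (v + w) = derLie I X v + derLie I X w := by
  ext g
  exact congrArg (fun T : TangentSpace I g →L[ℝ] LieAlg I G => T (X g))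
    (mvfderiv_add (lieFn_md I v g) (lieFn_md I w g))

lemma derLie_smul (X : VF I G) (f : Fn I G) (w : LieFn I G) :
    derLie I X (f • w) = f • derLie I X w + derFn I X f • w := by
  ext g
  exact congrArg (fun T : TangentSpace I g →L[ℝ] LieAlg I G => T (X g))
    (mvfderiv_smul (fn_md I f g) (lieFn_md I w g))

lemma derPath_add (X : VF I G) (v w : LiePath I G) :
    derPath I X (v + w) = derPath I X v + derPath I X w := by
  ext ⟨g, t⟩
  exact DFunLike.congr_fun (derLie_add I X (evalAt I t v) (evalAt I t w)) g

lemma derPath_smul (X : VF I G) (f : Fn I G) (w : LiePath I G) :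
    derPath I X (f • w) = f • derPath I X w + derFn I X f • w := by
  ext ⟨g, t⟩
  exact DFunLike.congr_fun (derLie_smul I X f (evalAt I t w)) g

lemma derPath_add_left (X Y : VF I G) (v : LiePath I G) :
    derPath I (X + Y) v = derPath I X v + derPath I Y v := by
  ext p; exact map_add (mvfderiv I (fun h => v (h, p.2)) p.1) (X p.1) (Y p.1)

lemma derPath_smul_left (f : Fn I G) (X : VF I G) (v : LiePath I G) :
    derPath I (f • X) v = f • derPath I X v := by
  ext p; exact map_smul (mvfderiv I (fun h => v (h, p.2)) p.1) (f p.1) (X p.1)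

variable (G) in
/-- Vector fields act on functions as derivations. -/
def vfDer : VF I G →ₗ[Fn I G] Derivation ℝ (Fn I G) (Fn I G) where
  toFun X := Derivation.mk'
    { toFun := derFn I X
      map_add' f f' := by
        ext g
        exact congrArg (fun T : TangentSpace I g →L[ℝ] ℝ => T (X g))
          (mvfderiv_add (fn_md I f g) (fn_md I f' g))
      map_smul' c f := by
        ext g
        have h := congrArg (fun T : TangentSpace I g →L[ℝ] ℝ => T (X g))
          (mvfderiv_smul (a := fun _ : G => c) mdifferentiableAt_const (fn_md I f g))
        simp only [mvfderiv_const] at h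
        refine h.trans ?_
        simp [derFn_apply] }
    (fun f f' => by
        ext g
        refine (congrArg (fun T : TangentSpace I g →L[ℝ] ℝ => T (X g))
          (mvfderiv_mul (fn_md I f g) (fn_md I f' g))).trans ?_
        rfl)
  map_add' X Y := by
    ext f g
    exact map_add (mvfderiv I f g) (X g) (Y g)
  map_smul' c X := by
    ext f g
    exact map_smul (mvfderiv I f g) (c g) (X g)

lemma vfDer_apply (X : VF I G) (f : Fn I G) : vfDer I G X f = derFn I X f := rfl

variable (G) in
/-- The pointwise bracket of `𝔤`-valued functions. -/
def lieFn : LieFn I G →ₗ[Fn I G] LieFn I G →ₗ[Fn I G] LieFn I G :=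
  LinearMap.mk₂ _ (fun x y => ⟨fun g => lieCLM I G (x g) (y g),
      (ContMDiff.clm_apply (contMDiff_const (c := lieCLM I G)) x.contMDiff).clm_apply y.contMDiff⟩)
    (fun x y z => by ext g; exact add_lie (x g) (y g) (z g))
    (fun c x y => by ext g; exact smul_lie (c g) (x g) (y g))
    (fun x y z => by ext g; exact lie_add (x g) (y g) (z g))
    (fun c x y => by ext g; exact lie_smul (c g) (x g) (y g))

lemma lieFn_apply (x y : LieFn I G) (g : G) : lieFn I G x y g = ⁅x g, y g⁆ := rfl

variable (G) in
/-- The pointwise bracket of paths. -/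
def liePath : LiePath I G →ₗ[Fn I G] LiePath I G →ₗ[Fn I G] LiePath I G :=
  LinearMap.mk₂ _ (fun x y => ⟨fun g => lieCLM I G (x g) (y g),
      (ContMDiff.clm_apply (contMDiff_const (c := lieCLM I G)) x.contMDiff).clm_apply y.contMDiff⟩)
    (fun x y z => by ext g; exact add_lie (x g) (y g) (z g))
    (fun c x y => by ext g; exact smul_lie (c g.1) (x g) (y g))
    (fun x y z => by ext g; exact lie_add (x g) (y g) (z g))
    (fun c x y => by ext g; exact lie_smul (c g.1) (x g) (y g))

lemma liePath_apply (x y : LiePath I G) (g : G) (t : ℝ) :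
    liePath I G x y (g, t) = ⁅x (g, t), y (g, t)⁆ := rfl

/-- The expression `-[ξ, ζ] + a(ξ) ζ - a(ζ) ξ`. -/
def brPath (x y : LiePath I G) : LiePath I G :=
  -liePath I G x y + derPath I (rightVF I (twist I x)) y - derPath I (rightVF I (twist I y)) x

lemma brPath_apply (x y : LiePath I G) (p : G × ℝ) : brPath I x y p =
    -⁅x p, y p⁆ + derPath I (rightVF I (twist I x)) y p -
      derPath I (rightVF I (twist I y)) x p := rfl

lemma derPath_periodic (z : LiePath I G) (u u' : LieFn I G)
    (hz : ∀ g t, z (g, t + 1) = Ad I g (z (g, t)) + u g) (g : G) (t : ℝ) :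
    derPath I (rightVF I u') z (g, t + 1) = ⁅u' g, Ad I g (z (g, t))⁆ +
      Ad I g (derPath I (rightVF I u') z (g, t)) + derLie I (rightVF I u') u g := by
  have e1 : evalAt I (t + 1) z = AdFn I (evalAt I t z) + u := by
    ext g; exact hz g t
  rw [derPath_apply, e1, ← derLie_apply, derLie_add]
  have e2 : derLie I (rightVF I u') (AdFn I (evalAt I t z)) g = ⁅u' g, Ad I g (z (g, t))⁆ +
      Ad I g (derPath I (rightVF I u') z (g, t)) :=
    mvfderiv_Ad_fun I (evalAt I t z) (evalAt I t z).contMDiff g (u' g)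
  rw [← e2]
  rfl

lemma brPath_periodic {x y : LiePath I G} (hx : x ∈ secA I G) (hy : y ∈ secA I G) (g : G) (t : ℝ) :
    brPath I x y (g, t + 1) = Ad I g (brPath I x y (g, t)) +
      (-lieFn I G (twist I x) (twist I y) + derLie I (rightVF I (twist I x)) (twist I y) -
        derLie I (rightVF I (twist I y)) (twist I x)) g := by
  have l3 : (-lieFn I G (twist I x) (twist I y) + derLie I (rightVF I (twist I x)) (twist I y) -
        derLie I (rightVF I (twist I y)) (twist I x)) g =
      -⁅twist I x g, twist I y g⁆ + derLie I (rightVF I (twist I x)) (twist I y) g -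
        derLie I (rightVF I (twist I y)) (twist I x) g := rfl
  rw [l3, brPath_apply, brPath_apply, derPath_periodic I x _ _ (secA_periodic I hx),
    derPath_periodic I y _ _ (secA_periodic I hy), secA_periodic I hx, secA_periodic I hy,
    map_sub, map_add, map_neg, Ad_lie]
  simp only [add_lie, lie_add]
  rw [← lie_skew (Ad I g (x (g, t))) (twist I y g)]
  abel

variable (G) in
/-- The bracket `[ξ, ζ]_A = -[ξ, ζ] + a(ξ) ζ - a(ζ) ξ` of sections of `A`. -/
def brA (x y : secA I G) : secA I G :=
  ⟨-liePath I G x y + derPath I (anchor I G x) y - derPath I (anchor I G y) x,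
    _, brPath_periodic I x.2 y.2⟩

variable (G) in
/-- The bracket of vector fields. -/
def brVF (X Y : VF I G) : VF I G :=
  haveI : CompleteSpace E := FiniteDimensional.complete ℝ E
  haveI : IsManifold I ((⊤ : ℕ∞) + 1) G := inferInstanceAs (IsManifold I ∞ G)
  haveI : IsManifold I (minSmoothness ℝ 2) G := by
    rw [minSmoothness_of_isRCLikeNormedField]; exact IsManifold.of_le (n := ∞) ENat.LEInfty.out
  have h := ContDiff.mlieBracket_vectorField (n := ⊤) (m := ⊤) X.contMDiff Y.contMDiff (by simp)
  ⟨fun g => mlieBracket I X Y g, h⟩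

end Derivatives

section Atiyah
variable [FiniteDimensional ℝ E]

lemma derLie_zero (X : VF I G) : derLie I X (0 : LieFn I G) = 0 := by
  have := derLie_add I X 0 0
  rw [add_zero] at this
  exact left_eq_add.1 this

lemma derLie_zero_left (v : LieFn I G) : derLie I (0 : VF I G) v = 0 := by
  ext g; exact map_zero (mvfderiv I v g)

lemma derPath_zero_left (v : LiePath I G) : derPath I (0 : VF I G) v = 0 := by
  ext p; exact map_zero (mvfderiv I (fun h => v (h, p.2)) p.1)

/-- The differential of functions and the bracket of vector fields: the tangent Lie algebroid. -/
def algT : AlgebroidData (Fn I G) (VF I G) where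
  act := vfDer I G
  br := brVF I G
  add_br X Y Z := by
    have : CompleteSpace E := FiniteDimensional.complete ℝ E
    have : IsManifold I (minSmoothness ℝ 3) G := by
      rw [minSmoothness_of_isRCLikeNormedField]; exact IsManifold.of_le (n := ∞) ENat.LEInfty.out
    ext g
    exact mlieBracket_add_left X.mdifferentiableAt Y.mdifferentiableAt
  br_skew X Y := by ext g; exact mlieBracket_swap_apply
  br_self X := by
    ext g
    exact congrFun (mlieBracket_self (I := I) (V := X)) g
  br_smul X f Y := by
    have : CompleteSpace E := FiniteDimensional.complete ℝ E
    have : IsManifold I (minSmoothness ℝ 3) G := by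
      rw [minSmoothness_of_isRCLikeNormedField]; exact IsManifold.of_le (n := ∞) ENat.LEInfty.out
    ext g
    exact (mlieBracket_smul_right (fn_md I f g) Y.mdifferentiableAt).trans (add_comm _ _)

/-- The Atiyah algebroid of the path fibration. -/
def algA : AlgebroidData (Fn I G) (secA I G) where
  act := vfDer I G ∘ₗ anchor I G
  br := brA I G
  add_br x y z := Subtype.ext <| by
    change -liePath I G (x + y) z + derPath I (anchor I G (x + y)) z
      - derPath I (anchor I G z) (x + y) = (-liePath I G x z + derPath I (anchor I G x) z
      - derPath I (anchor I G z) x) + (-liePath I G y z + derPath I (anchor I G y) z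
      - derPath I (anchor I G z) y)
    rw [map_add, map_add, derPath_add, derPath_add_left, LinearMap.add_apply]
    abel
  br_skew x y := Subtype.ext <| by
    have h : liePath I G (y : LiePath I G) x = -liePath I G (x : LiePath I G) y := by
      ext p; exact (lie_skew _ _).symm
    change -liePath I G y x + derPath I (anchor I G y) x
      - derPath I (anchor I G x) y = -(-liePath I G x y + derPath I (anchor I G x) y
      - derPath I (anchor I G y) x)
    rw [h]; abel
  br_self x := Subtype.ext <| by
    have h : liePath I G (x : LiePath I G) x = 0 := by
      ext p; exact lie_self _
    change -liePath I G x x + derPath I (anchor I G x) x - derPath I (anchor I G x) x = 0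
    rw [h]; abel
  br_smul x f y := Subtype.ext <| by
    change -liePath I G x (f • (y : LiePath I G)) + derPath I (anchor I G x) (f • (y : LiePath I G))
      - derPath I (anchor I G (f • y)) x = f • (-liePath I G x y + derPath I (anchor I G x) y
      - derPath I (anchor I G y) x) + derFn I (anchor I G x) f • (y : LiePath I G)
    rw [map_smul, map_smul, derPath_smul, derPath_smul_left, smul_sub, smul_add, smul_neg]
    abel

variable (G) in
/-- The sections of `L = ker a`. -/
abbrev secL : Submodule (Fn I G) (secA I G) := LinearMap.ker (anchor I G)

lemma mem_secL_iff (x : secA I G) : x ∈ secL I G ↔ twist I (x : LiePath I G) = 0 := by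
  constructor
  · intro h
    have := congrArg (thetaRForm I) (LinearMap.mem_ker.1 h)
    rw [map_zero] at this
    exact (thetaRForm_rightVF I _).symm.trans this
  · intro h
    exact LinearMap.mem_ker.2 ((congrArg (rightVF I) h).trans (map_zero _))

lemma brA_mem_secL (x : secA I G) {y : secA I G} (hy : y ∈ secL I G) : brA I G x y ∈ secL I G := by
  rw [mem_secL_iff] at hy ⊢
  refine (twist_eq I (brPath_periodic I x.2 y.2)).trans ?_
  rw [hy, map_zero, derLie_zero, map_zero, derLie_zero_left]
  abel

variable (G) in
/-- The `C^∞(G)`-module of sections of `L = ker a`. -/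
def SecL : Type _ := secL I G

instance : AddCommGroup (SecL I G) := inferInstanceAs (AddCommGroup (secL I G))
instance : Module (Fn I G) (SecL I G) := inferInstanceAs (Module (Fn I G) (secL I G))
instance : Module ℝ (SecL I G) := inferInstanceAs (Module ℝ (secL I G))
instance : SMulCommClass (Fn I G) ℝ (SecL I G) :=
  inferInstanceAs (SMulCommClass (Fn I G) ℝ (secL I G))
instance : SMulCommClass ℝ (Fn I G) (SecL I G) :=
  inferInstanceAs (SMulCommClass ℝ (Fn I G) (secL I G))

/-- `∇_ξ ζ = [ξ, ζ]_A` for `ζ` in `L`. -/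
def nablaL (x : secA I G) : SecL I G →+ SecL I G where
  toFun y := ⟨brA I G x y.1, brA_mem_secL I x y.2⟩
  map_zero' := Subtype.ext <| by
    have h := (algA I).br_smul x 0 (0 : secA I G)
    rwa [zero_smul, zero_smul, map_zero, zero_smul, add_zero] at h
  map_add' y z := Subtype.ext <| by
    have h := (algA I).add_br y.1 z.1 x
    have h' := congrArg Neg.neg h
    rw [neg_add, ← (algA I).br_skew, ← (algA I).br_skew, ← (algA I).br_skew] at h'
    exact h'

lemma nablaL_add (x y : secA I G) (z : SecL I G) : nablaL I (x + y) z = nablaL I x z + nablaL I y z :=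
  Subtype.ext ((algA I).add_br x y z.1)

lemma nablaL_smul_left (f : Fn I G) (x : secA I G) (z : SecL I G) :
    nablaL I (f • x) z = f • nablaL I x z := by
  refine Subtype.ext (((algA I).smul_br f x z.1).trans ?_)
  have : (algA I).act z.1 f = 0 := by
    change vfDer I G (anchor I G z.1) f = 0
    rw [LinearMap.mem_ker.1 z.2, map_zero]; rfl
  rw [this, zero_smul, sub_zero]
  rfl

lemma nablaL_smul (x : secA I G) (f : Fn I G) (z : SecL I G) :
    nablaL I x (f • z) = f • nablaL I x z + (algA I).act x f • z := by
  have h := (algA I).br_smul x f z.1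
  exact Subtype.ext h

/-- The representation of `A` on `L`, given by `∇_ξ ζ = [ξ, ζ]_A`. -/
def connL : (algA I (G := G)).Conn (SecL I G) where
  nabla :=
    { toFun := nablaL I
      map_add' x y := AddMonoidHom.ext (nablaL_add I x y)
      map_smul' f x := AddMonoidHom.ext (nablaL_smul_left I f x) }
  leib := nablaL_smul I

lemma liePath_mem_secA (x y : SecL I G) (g : G) (t : ℝ) :
    (-liePath I G x.1.1 y.1.1) (g, t + 1) =
      Ad I g ((-liePath I G x.1.1 y.1.1) (g, t)) + (0 : LieFn I G) g := by
  have hx := (mem_secL_iff I _).1 x.2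
  have hy := (mem_secL_iff I _).1 y.2
  have h1 := secA_periodic I x.1.2 g t
  have h2 := secA_periodic I y.1.2 g t
  rw [hx] at h1
  rw [hy] at h2
  change -⁅x.1.1 (g, t + 1), y.1.1 (g, t + 1)⁆ =
    Ad I g (-⁅x.1.1 (g, t), y.1.1 (g, t)⁆) + 0
  rw [h1, h2, map_neg, Ad_lie, add_zero]
  exact congrArg Neg.neg (congrArg₂ Bracket.bracket (add_zero _) (add_zero _))

variable (G) in
/-- The bracket `[ξ, ζ]_L = -[ξ, ζ]_𝔤` on sections of `L`. -/
def lieL : SecL I G →ₗ[Fn I G] SecL I G →ₗ[Fn I G] SecL I G :=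
  LinearMap.mk₂ _
    (fun x y => ⟨⟨-liePath I G x.1.1 y.1.1, 0, liePath_mem_secA I x y⟩,
      (mem_secL_iff I _).2 (twist_eq I (liePath_mem_secA I x y))⟩)
    (fun x y z => Subtype.ext (Subtype.ext (by
      change -liePath I G (x.1.1 + y.1.1) z.1.1 = -liePath I G x.1.1 z.1.1 + -liePath I G y.1.1 z.1.1
      rw [map_add, LinearMap.add_apply, neg_add])))
    (fun f x z => Subtype.ext (Subtype.ext (by
      change -liePath I G (f • x.1.1) z.1.1 = f • -liePath I G x.1.1 z.1.1
      rw [map_smul, LinearMap.smul_apply, smul_neg])))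
    (fun x y z => Subtype.ext (Subtype.ext (by
      change -liePath I G x.1.1 (y.1.1 + z.1.1) = -liePath I G x.1.1 y.1.1 + -liePath I G x.1.1 z.1.1
      rw [map_add, neg_add])))
    (fun f x z => Subtype.ext (Subtype.ext (by
      change -liePath I G x.1.1 (f • z.1.1) = f • -liePath I G x.1.1 z.1.1
      rw [map_smul, smul_neg])))

end Atiyah

section Pairing
variable [FiniteDimensional ℝ E]

lemma path_contDiff (x : LiePath I G) (g : G) : ContDiff ℝ ∞ (fun s => x (g, s)) := by
  have h : ContMDiff 𝓘(ℝ, ℝ) 𝓘(ℝ, LieAlg I G) ∞ (fun s : ℝ => x (g, s)) :=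
    x.contMDiff.comp (contMDiff_const.prodMk contMDiff_id)
  exact h.contDiff

lemma smooth_timeDeriv (x : LiePath I G) :
    ContMDiff (I.prod 𝓘(ℝ, ℝ)) 𝓘(ℝ, LieAlg I G) ∞
      (fun p : G × ℝ => deriv (fun s => x (p.1, s)) p.2) := by
  have hs : ContMDiff (I.prod 𝓘(ℝ, ℝ)) 𝓘(ℝ, ℝ).tangent ∞
      (fun p : G × ℝ => (⟨p.2, (1 : ℝ)⟩ : TangentBundle 𝓘(ℝ, ℝ) ℝ)) :=
    (smooth_vec_iff (J := I.prod 𝓘(ℝ, ℝ)) (fun p : G × ℝ => p.2) (fun _ => (1 : ℝ))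
      contMDiff_snd).2 contMDiff_const
  have hF : ContMDiff (𝓘(ℝ, ℝ).prod (I.prod 𝓘(ℝ, ℝ))) 𝓘(ℝ, LieAlg I G) ∞
      (fun q : ℝ × (G × ℝ) => x (q.2.1, q.1)) :=
    x.contMDiff.comp ((contMDiff_fst.comp contMDiff_snd).prodMk contMDiff_fst)
  have h := partial_smooth 𝓘(ℝ, ℝ) (X := ℝ) (J := I.prod 𝓘(ℝ, ℝ)) (I' := 𝓘(ℝ, LieAlg I G))
    (fun q : ℝ × (G × ℝ) => x (q.2.1, q.1)) hF _ hs
  have h2 := (smooth_vec_iff (J := I.prod 𝓘(ℝ, ℝ)) (fun p : G × ℝ => x p)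
    (fun p => (mfderiv 𝓘(ℝ, ℝ) 𝓘(ℝ, LieAlg I G) (fun s => x (p.1, s)) p.2 : ℝ →L[ℝ] LieAlg I G) 1)
    x.contMDiff).1 h
  refine h2.congr fun p => ?_
  rw [mfderiv_eq_fderiv]
  exact fderiv_apply_one_eq_deriv.symm

variable (G) in
/-- The time derivative of a path. -/
def timeDeriv : LiePath I G →ₗ[Fn I G] LiePath I G where
  toFun x := ⟨fun p => deriv (fun s => x (p.1, s)) p.2, smooth_timeDeriv I x⟩
  map_add' x y := by
    ext p
    exact deriv_add (((path_contDiff I x p.1).differentiable (by simp)) p.2)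
      (((path_contDiff I y p.1).differentiable (by simp)) p.2)
  map_smul' f x := by
    ext p
    exact deriv_const_smul (f p.1) (((path_contDiff I x p.1).differentiable (by simp)) p.2)

variable (G) in
/-- An invariant symmetric bilinear form on `𝔤`. -/
structure InvForm where
  /-- the bilinear form -/
  form : LinearMap.BilinForm ℝ (LieAlg I G)
  symm : ∀ x y, form x y = form y x
  inv : ∀ (g : G) x y, form (Ad I g x) (Ad I g y) = form x y

variable {I}
/-- The form as a continuous bilinear map. -/
def InvForm.clm (B : InvForm I G) : LieAlg I G →L[ℝ] LieAlg I G →L[ℝ] ℝ :=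
  LinearMap.toContinuousLinearMap
    ((LinearMap.toContinuousLinearMap (E := LieAlg I G) (F' := ℝ)).toLinearMap ∘ₗ B.form)

/-- The pointwise pairing of `𝔤`-valued functions. -/
def InvForm.pair (B : InvForm I G) : LieFn I G →ₗ[Fn I G] LieFn I G →ₗ[Fn I G] Fn I G :=
  LinearMap.mk₂ _ (fun x y => ⟨fun g => B.form (x g) (y g),
      (ContMDiff.clm_apply (contMDiff_const (c := B.clm)) x.contMDiff).clm_apply y.contMDiff⟩)
    (fun x y z => by ext g; exact LinearMap.map_add₂ B.form (x g) (y g) (z g))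
    (fun c x y => by ext g; exact LinearMap.map_smul₂ B.form (c g) (x g) (y g))
    (fun x y z => by ext g; exact map_add (B.form (x g)) (y g) (z g))
    (fun c x y => by ext g; exact map_smul (B.form (x g)) (c g) (y g))

lemma InvForm.smooth_path (B : InvForm I G) (x y : LiePath I G) :
    ContMDiff (I.prod 𝓘(ℝ, ℝ)) 𝓘(ℝ, ℝ) ∞ (fun p => B.form (x p) (y p)) :=
  (ContMDiff.clm_apply (contMDiff_const (c := B.clm)) x.contMDiff).clm_apply y.contMDiff

lemma InvForm.int_path (B : InvForm I G) (x y : LiePath I G) (g : G) :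
    IntervalIntegrable (fun t => B.form (x (g, t)) (y (g, t))) MeasureTheory.volume 0 1 := by
  have h : Continuous (fun p => B.form (x p) (y p)) := (B.smooth_path x y).continuous
  exact (h.comp (Continuous.prodMk_right g)).intervalIntegrable 0 1

/-- The pairing `∫₀¹ x_t · y_t dt` of paths. -/
def InvForm.intPair (B : InvForm I G) : LiePath I G →ₗ[Fn I G] LiePath I G →ₗ[Fn I G] Fn I G :=
  LinearMap.mk₂ _ (fun x y => ⟨fun g => ∫ t in (0 : ℝ)..1, B.form (x (g, t)) (y (g, t)),
      smooth_integral I _ (B.smooth_path x y)⟩)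
    (fun x y z => by
      ext g
      exact (intervalIntegral.integral_congr fun t _ =>
        LinearMap.map_add₂ B.form (x (g, t)) (y (g, t)) (z (g, t))).trans
          (intervalIntegral.integral_add (B.int_path x z g) (B.int_path y z g)))
    (fun c x y => by
      ext g
      exact (intervalIntegral.integral_congr fun t _ =>
        LinearMap.map_smul₂ B.form (c g) (x (g, t)) (y (g, t))).trans
          (intervalIntegral.integral_smul (c g) _))
    (fun x y z => by
      ext g
      exact (intervalIntegral.integral_congr fun t _ =>
        map_add (B.form (x (g, t))) (y (g, t)) (z (g, t))).trans
          (intervalIntegral.integral_add (B.int_path x y g) (B.int_path x z g)))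
    (fun c x y => by
      ext g
      exact (intervalIntegral.integral_congr fun t _ =>
        map_smul (B.form (x (g, t))) (c g) (y (g, t))).trans
          (intervalIntegral.integral_smul (c g) _))

variable (I G) in
/-- The sections of `L̂ = L ⊕ ℝ`. -/
abbrev SecHat := SecL I G × Fn I G

/-- The bracket `[(ξ, s), (ζ, u)] = (-[ξ, ζ], ∫₀¹ ξ̇ · ζ)` on sections of `L̂`. -/
def InvForm.lieHat (B : InvForm I G) : SecHat I G →ₗ[Fn I G] SecHat I G →ₗ[Fn I G] SecHat I G :=
  LinearMap.mk₂ _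
    (fun x y => (lieL I G x.1 y.1, B.intPair (timeDeriv I G x.1.1.1) y.1.1.1))
    (fun x y z => Prod.ext (LinearMap.map_add₂ (lieL I G) x.1 y.1 z.1) (by
      change B.intPair (timeDeriv I G (x.1.1.1 + y.1.1.1)) z.1.1.1 = _
      rw [map_add, LinearMap.map_add₂]; rfl))
    (fun f x z => Prod.ext (LinearMap.map_smul₂ (lieL I G) f x.1 z.1) (by
      change B.intPair (timeDeriv I G (f • x.1.1.1)) z.1.1.1 = _
      rw [map_smul, LinearMap.map_smul₂]; rfl))
    (fun x y z => Prod.ext (map_add (lieL I G x.1) y.1 z.1)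
      (map_add (B.intPair (timeDeriv I G x.1.1.1)) y.1.1.1 z.1.1.1))
    (fun f x z => Prod.ext (map_smul (lieL I G x.1) f z.1)
      (map_smul (B.intPair (timeDeriv I G x.1.1.1)) f z.1.1.1))

/-- `∇̂_ξ (ζ, s) = (∇_ξ ζ, a(ξ) s + ∫₀¹ ξ̇ · ζ)`. -/
def InvForm.nablaHat (B : InvForm I G) (x : secA I G) : SecHat I G →+ SecHat I G where
  toFun y := (nablaL I x y.1, derFn I (anchor I G x) y.2 + B.intPair (timeDeriv I G x.1) y.1.1.1)
  map_zero' := Prod.ext (map_zero _) (by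
    change vfDer I G (anchor I G x) 0 + B.intPair (timeDeriv I G x.1) 0 = 0
    rw [map_zero, map_zero, add_zero])
  map_add' y z := Prod.ext (map_add _ y.1 z.1) (by
    change vfDer I G (anchor I G x) (y.2 + z.2) + B.intPair (timeDeriv I G x.1)
      (y.1.1.1 + z.1.1.1) =
      (vfDer I G (anchor I G x) y.2 + B.intPair (timeDeriv I G x.1) y.1.1.1) +
      (vfDer I G (anchor I G x) z.2 + B.intPair (timeDeriv I G x.1) z.1.1.1)
    rw [map_add, map_add]; abel)

/-- The representation of `A` on `L̂`. -/
def InvForm.connHat (B : InvForm I G) : (algA I (G := G)).Conn (SecHat I G) where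
  nabla :=
    { toFun := B.nablaHat
      map_add' x y := AddMonoidHom.ext fun z => Prod.ext (nablaL_add I x y z.1) (by
        change vfDer I G (anchor I G (x + y)) z.2 + B.intPair (timeDeriv I G
            (x.1 + y.1)) z.1.1.1 =
          (vfDer I G (anchor I G x) z.2 + B.intPair (timeDeriv I G x.1) z.1.1.1) +
          (vfDer I G (anchor I G y) z.2 + B.intPair (timeDeriv I G y.1) z.1.1.1)
        rw [map_add, map_add, map_add, Derivation.add_apply, map_add, LinearMap.add_apply]; abel)
      map_smul' f x := AddMonoidHom.ext fun z => Prod.ext (nablaL_smul_left I f x z.1) (by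
        change vfDer I G (anchor I G (f • x)) z.2 + B.intPair (timeDeriv I G
            (f • x.1)) z.1.1.1 =
          f • (vfDer I G (anchor I G x) z.2 + B.intPair (timeDeriv I G x.1) z.1.1.1)
        rw [map_smul, map_smul, map_smul, Derivation.smul_apply, map_smul, LinearMap.smul_apply,
          smul_add]) }
  leib x f y := Prod.ext (nablaL_smul I x f y.1) (by
    change vfDer I G (anchor I G x) (f * y.2) + B.intPair (timeDeriv I G x.1)
        (f • y.1.1.1) =
      f * (vfDer I G (anchor I G x) y.2 + B.intPair (timeDeriv I G x.1) y.1.1.1) +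
        vfDer I G (anchor I G x) f * y.2
    rw [Derivation.leibniz, LinearMap.map_smul]
    simp only [smul_eq_mul]
    ring)

end Pairing

section Forms
variable [FiniteDimensional ℝ E]
variable (G)

/-- `θ^L`, pulled back to `A`. -/
def thetaLA : secA I G →ₗ[Fn I G] LieFn I G := thetaLForm I ∘ₗ anchor I G

/-- The differential `Ω²(G) → Ω³(G)`. -/
def dG2 : (VF I G) [⋀^Fin 2]→ₗ[Fn I G] (Fn I G) →
    (VF I G) [⋀^Fin 3]→ₗ[Fn I G] (Fn I G) := d2 (algT I (G := G)).trivConn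

/-- The differential `Ω²(A) → Ω³(A)`. -/
def dA2 : (secA I G) [⋀^Fin 2]→ₗ[Fn I G] (Fn I G) →
    (secA I G) [⋀^Fin 3]→ₗ[Fn I G] (Fn I G) := d2 (algA I (G := G)).trivConn

/-- A smooth family of forms `α_t ∈ Ω¹(G, 𝔤)` with `α_{t+1} = Ad_g α_t - θ^R`, as the map sending a
vector field `X` to the function `(g, t) ↦ α_t(X)(g)`. -/
structure ConnFamily where
  /-- the family of forms -/
  form : VF I G →ₗ[Fn I G] LiePath I G
  periodic : ∀ X g t, form X (g, t + 1) = Ad I g (form X (g, t)) - thetaR I g (X g)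

variable {G} {I}

lemma ConnFamily.sum_periodic (α : ConnFamily I G) (x : secA I G) (g : G) (t : ℝ) :
    ((x : LiePath I G) + α.form (anchor I G x)) (g, t + 1) =
      Ad I g (((x : LiePath I G) + α.form (anchor I G x)) (g, t)) + (0 : LieFn I G) g := by
  have h1 := secA_periodic I x.2 g t
  have h2 := α.periodic (anchor I G x) g t
  have h3 : thetaR I g (anchor I G x g) = twist I (x : LiePath I G) g :=
    DFunLike.congr_fun (thetaRForm_rightVF I (twist I (x : LiePath I G))) g
  rw [h3] at h2
  change (x : LiePath I G) (g, t + 1) + α.form (anchor I G x) (g, t + 1) =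
    Ad I g ((x : LiePath I G) (g, t) + α.form (anchor I G x) (g, t)) + 0
  rw [h1, h2, map_add, add_zero]
  abel

/-- The connection `θ^α(ξ) = ξ + α(a(ξ))`, with values in `L`. -/
def ConnFamily.theta (α : ConnFamily I G) : secA I G →ₗ[Fn I G] SecL I G where
  toFun x := ⟨⟨(x : LiePath I G) + α.form (anchor I G x), 0, α.sum_periodic x⟩,
    (mem_secL_iff I _).2 (twist_eq I (α.sum_periodic x))⟩
  map_add' x y := Subtype.ext (Subtype.ext (by
    change (x : LiePath I G) + (y : LiePath I G) + α.form (anchor I G (x + y)) =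
      ((x : LiePath I G) + α.form (anchor I G x)) + ((y : LiePath I G) + α.form (anchor I G y))
    rw [map_add, map_add]; abel))
  map_smul' f x := Subtype.ext (Subtype.ext (by
    change f • (x : LiePath I G) + α.form (anchor I G (f • x)) =
      f • ((x : LiePath I G) + α.form (anchor I G x))
    rw [map_smul, map_smul, smul_add]))

/-- The curvature `F^θ = dθ - ½ [θ, θ]_L`. -/
def curvL (θ : secA I G →ₗ[Fn I G] SecL I G) : (secA I G) [⋀^Fin 2]→ₗ[Fn I G] (SecL I G) :=
  d1 (R := Fn I G) (connL I) θ - (1 / 2 : ℝ) • wedge11 (R := Fn I G) (Γ := secA I G) (U := SecL I G) (W := SecL I G) (V := SecL I G) (lieL I G) θ θ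

/-- The expression `dψ - ½ [ψ, ψ]` for an `L̂`-valued form `ψ`. -/
def InvForm.curvHat (B : InvForm I G) (ψ : secA I G →ₗ[Fn I G] SecHat I G) :
    (secA I G) [⋀^Fin 2]→ₗ[Fn I G] (SecHat I G) :=
  d1 (R := Fn I G) B.connHat ψ - (1 / 2 : ℝ) • wedge11 (R := Fn I G) (Γ := secA I G) (U := SecHat I G) (W := SecHat I G)
    (V := SecHat I G) B.lieHat ψ ψ

variable (I G) in
/-- The splitting `j : L → L̂`, `j(ξ) = (ξ, 0)`. -/
def splitHat : SecL I G →ₗ[Fn I G] SecHat I G := LinearMap.inl (Fn I G) (SecL I G) (Fn I G)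

/-- The `L̂`-valued form `F^{j(θ)} - j(F^θ)`. -/
def InvForm.defect (B : InvForm I G) (θ : secA I G →ₗ[Fn I G] SecL I G) :
    (secA I G) [⋀^Fin 2]→ₗ[Fn I G] (SecHat I G) :=
  B.curvHat (splitHat I G ∘ₗ θ) - (splitHat I G).compAlternatingMap (curvL θ)

/-- The `L`-component of `F^{j(θ)} - j(F^θ)` vanishes. -/
lemma InvForm.defect_fst (B : InvForm I G) (θ : secA I G →ₗ[Fn I G] SecL I G) :
    (LinearMap.fst (Fn I G) (SecL I G) (Fn I G)).compAlternatingMap (B.defect θ) = 0 := by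
  ext1 v
  exact sub_self (curvL θ v)

/-- The `2`-form `ϖ^α = F^{j(θ^α)} - j(F^{θ^α}) ∈ Ω²(A)`. -/
def InvForm.varpiConn (B : InvForm I G) (α : ConnFamily I G) :
    (secA I G) [⋀^Fin 2]→ₗ[Fn I G] (Fn I G) :=
  (LinearMap.snd (Fn I G) (SecL I G) (Fn I G)).compAlternatingMap (B.defect α.theta)

/-- `½ Θ · β_0 + ½ ∫₀¹ β_t · β̇_t dt` for a `1`-form `Θ` and a family of `1`-forms `β_t`. -/
def InvForm.Q {Γ : Type*} [AddCommGroup Γ] [Module (Fn I G) Γ] (B : InvForm I G)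
    (Θ : Γ →ₗ[Fn I G] LieFn I G) (β : Γ →ₗ[Fn I G] LiePath I G) :
    Γ [⋀^Fin 2]→ₗ[Fn I G] (Fn I G) :=
  (1 / 2 : ℝ) • wedge11 (R := Fn I G) B.pair Θ (evalAt I 0 ∘ₗ β) +
    (1 / 2 : ℝ) • wedge11 (R := Fn I G) B.intPair β (timeDeriv I G ∘ₗ β)

/-- `Q^α ∈ Ω²(G)`. -/
def InvForm.QConn (B : InvForm I G) (α : ConnFamily I G) :
    (VF I G) [⋀^Fin 2]→ₗ[Fn I G] (Fn I G) := B.Q (thetaLForm I) α.form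

variable (I G) in
/-- The family of forms `κ_t(ξ) = -ξ_t` on `A`. -/
def kappa : secA I G →ₗ[Fn I G] LiePath I G := -(secA I G).subtype

/-- The `2`-form `ϖ = -½ ∫₀¹ κ_t · κ̇_t dt - ½ a^*θ^L · κ_0`. -/
def InvForm.varpi (B : InvForm I G) : (secA I G) [⋀^Fin 2]→ₗ[Fn I G] (Fn I G) :=
  -((1 / 2 : ℝ) • wedge11 (R := Fn I G) B.intPair (kappa I G) (timeDeriv I G ∘ₗ kappa I G)) -
    (1 / 2 : ℝ) • wedge11 (R := Fn I G) B.pair (thetaLA I G) (evalAt I 0 ∘ₗ kappa I G)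

/-- The Cartan `3`-form `η = (1/12) θ^L · [θ^L, θ^L]`. -/
def InvForm.eta (B : InvForm I G) : (VF I G) [⋀^Fin 3]→ₗ[Fn I G] (Fn I G) :=
  (1 / 12 : ℝ) • wedge12 (R := Fn I G) B.pair (thetaLForm I) (wedge11 (R := Fn I G) (lieFn I G) (thetaLForm I) (thetaLForm I))

variable (I) in
lemma smooth_leftField (x : LieAlg I G) :
    ContMDiff I I.tangent ∞ (fun g : G => (⟨g, leftField I g x⟩ : TangentBundle I G)) :=
  (rightVF I (AdFn I ⟨fun _ => x, contMDiff_const⟩)).contMDiff.congr fun g =>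
    congrArg (fun v : E => (⟨g, v⟩ : TangentBundle I G)) (rightField_Ad_aux I g x).symm

variable (I) in
lemma smooth_conj (k : G) : ContMDiff I I ∞ (fun g : G => k⁻¹ * g * k) :=
  (mul_right_smooth I k).comp (mul_left_smooth I k⁻¹)

variable (I) in
lemma smooth_actVF (k : G) (X : VF I G) : ContMDiff I I.tangent ∞ (fun g : G => (⟨g,
    (mfderiv I I (fun h : G => k * h * k⁻¹) (k⁻¹ * g * k) : E →L[ℝ] E)
      (X (k⁻¹ * g * k))⟩ : TangentBundle I G)) := by
  have hF : ContMDiff (I.prod I) I ∞ (fun q : G × G => k * q.1 * k⁻¹) :=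
    ((mul_right_smooth I k⁻¹).comp (mul_left_smooth I k)).comp contMDiff_fst
  have h := partial_smooth I (J := I) (I' := I) (fun q : G × G => k * q.1 * k⁻¹) hF
    (fun g => ⟨k⁻¹ * g * k, X (k⁻¹ * g * k)⟩) (X.contMDiff.comp (smooth_conj I k))
  exact h.congr fun g => tb_mk_eq I (by simp [mul_assoc]) _

variable (I G) in
/-- The constant function with value `x`. -/
def constLie (x : LieAlg I G) : LieFn I G := ⟨fun _ => x, contMDiff_const⟩

variable (I G) in
/-- The generators `x_A = -x` of the `G`-action on `A`. -/
def genA (x : LieAlg I G) : secA I G :=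
  ⟨⟨fun _ => -x, contMDiff_const⟩, constLie I G (-x) - AdFn I (constLie I G (-x)), fun g _ =>
    (add_sub_cancel (Ad I g (-x)) (-x)).symm⟩

variable (I G) in
/-- The generators `x_G = x^L - x^R` of the conjugation action on `G`, where `x^L` and `x^R` are the
left- and right-invariant vector fields with value `x` at the unit. -/
def genG (x : LieAlg I G) : VF I G :=
  ⟨fun g => leftField I g x, smooth_leftField I x⟩ -
    ⟨fun g => rightField I g x, (rightVF I (constLie I G x)).contMDiff⟩

/-- The action `(k.f)(g) = f(k⁻¹ g k)` on functions. -/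
def actFn (k : G) (f : Fn I G) : Fn I G :=
  ⟨fun g => f (k⁻¹ * g * k), f.contMDiff.comp (smooth_conj I k)⟩

/-- The action `(k.x)(g, t) = Ad_k x(k⁻¹ g k, t)` on paths. -/
def actPath (k : G) (x : LiePath I G) : LiePath I G :=
  ⟨fun p => Ad I k (x (k⁻¹ * p.1 * k, p.2)), (Ad I k).contDiff.contMDiff.comp
    (x.contMDiff.comp (((smooth_conj I k).comp contMDiff_fst).prodMk contMDiff_snd))⟩

/-- The action of `G` on sections of `A`. -/
def actA (k : G) (x : secA I G) : secA I G :=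
  ⟨actPath k x.1, ⟨fun g => Ad I k (twist I x.1 (k⁻¹ * g * k)),
    (Ad I k).contDiff.contMDiff.comp ((twist I x.1).contMDiff.comp (smooth_conj I k))⟩, fun g t => by
      have h := secA_periodic I x.2 (k⁻¹ * g * k) t
      change Ad I k (x.1 (k⁻¹ * g * k, t + 1)) = Ad I g (Ad I k (x.1 (k⁻¹ * g * k, t))) +
        Ad I k (twist I x.1 (k⁻¹ * g * k))
      rw [h, map_add, ← Ad_mul, ← Ad_mul]
      congr 3
      group⟩

/-- The push-forward of vector fields under conjugation by `k`. -/
def actVF (k : G) (X : VF I G) : VF I G :=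
  ⟨fun g => (mfderiv I I (fun h : G => k * h * k⁻¹) (k⁻¹ * g * k) : E →L[ℝ] E)
    (X (k⁻¹ * g * k)), smooth_actVF I k X⟩

/-- `G`-invariance of a `2`-form on `A`. -/
def InvariantA (om : (secA I G) [⋀^Fin 2]→ₗ[Fn I G] (Fn I G)) : Prop :=
  ∀ (k : G) (x y : secA I G), om ![actA k x, actA k y] = actFn k (om ![x, y])

/-- `G`-invariance of a `2`-form on `G`. -/
def InvariantG (om : (VF I G) [⋀^Fin 2]→ₗ[Fn I G] (Fn I G)) : Prop :=
  ∀ (k : G) (X Y : VF I G), om ![actVF k X, actVF k Y] = actFn k (om ![X, Y])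

/-- `G`-invariance of the family `α_t`, i.e. `k^*α_t = Ad_k α_t`. -/
def ConnFamily.Invariant (α : ConnFamily I G) : Prop :=
  ∀ (k : G) (X : VF I G), α.form (actVF k X) = actPath k (α.form X)

/-- The pull-back of `k`-forms under the anchor. -/
def pullA {n : ℕ} (om : (VF I G) [⋀^Fin n]→ₗ[Fn I G] (Fn I G)) :
    (secA I G) [⋀^Fin n]→ₗ[Fn I G] (Fn I G) := om.compLinearMap (anchor I G)

variable (I G) in
/-- The values, at an element of `𝔤`, of equivariant `3`-forms on `G`: a `3`-form and a `1`-form. -/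
abbrev EqG := ((VF I G) [⋀^Fin 3]→ₗ[Fn I G] (Fn I G)) × (VF I G →ₗ[Fn I G] Fn I G)

variable (I G) in
/-- The values, at an element of `𝔤`, of equivariant `3`-forms on `A`: a `3`-form and a `1`-form. -/
abbrev EqA := ((secA I G) [⋀^Fin 3]→ₗ[Fn I G] (Fn I G)) × (secA I G →ₗ[Fn I G] Fn I G)

/-- The pull-back of equivariant forms under the anchor. -/
def pullEq (om : EqG I G) : EqA I G := (pullA om.1, om.2 ∘ₗ anchor I G)

/-- The equivariant differential `(d_G ω)(x) = dω - ι(x_G) ω` of a `2`-form on `G`. -/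
def dEqG (om : (VF I G) [⋀^Fin 2]→ₗ[Fn I G] (Fn I G)) (x : LieAlg I G) : EqG I G :=
  (dG2 I G om, -contract (R := Fn I G) (genG I G x) om)

/-- The equivariant differential `(d_G ω)(x) = dω - ι(x_A) ω` of a `2`-form on `A`. -/
def dEqA (om : (secA I G) [⋀^Fin 2]→ₗ[Fn I G] (Fn I G)) (x : LieAlg I G) : EqA I G :=
  (dA2 I G om, -contract (R := Fn I G) (genA I G x) om)

/-- `η_G(x) = η - ½ (θ^L + θ^R) · x`. -/
def InvForm.etaEq (B : InvForm I G) (x : LieAlg I G) : EqG I G :=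
  (B.eta, -((1 / 2 : ℝ) • (B.pair.flip (constLie I G x) ∘ₗ (thetaLForm I + thetaRForm I))))

end Forms

end
end PathFibration
end

open PathFibration

noncomputable section
set_option linter.unusedSectionVars false
namespace PathFibration
open VectorField Set Filter Topology
section
variable {E : Type*} [NormedAddCommGroup E] [NormedSpace ℝ E]
  {H : Type*} [TopologicalSpace H] (I : ModelWithCorners ℝ E H) [I.Boundaryless]
  {G : Type*} [TopologicalSpace G] [ChartedSpace H G] [Group G] [LieGroup I ∞ G]

/-! ### Translations, Maurer–Cartan forms and the adjoint action -/

section Translations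

/-! The theorem reduces to the identity d_G ϖ = a^*η_G for the explicit form ϖ, because ϖ^α = ϖ +
a^*Q^α (`InvForm.varpiConn_eq`) and a^* commutes with d_G (`dEqA_pullA`).

For the decomposition, insert θ^α(ξ) = ξ + α(a(ξ)) into the ℝ-component of F^{j(θ)} - j(F^θ). The
part quadratic in ξ and the part quadratic in α are the integrals occurring in ϖ and Q^α. The mixed
part is the integral of a total t-derivative, so it only sees t = 0 and t = 1. There the
quasi-periodicity reads ξ_1 = Ad_g(ξ_0 + θ^L(a(ξ))) and α_1 = Ad_g(α_0 - θ^L); Ad-invariance of the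
form removes Ad_g, and what is left are the terms with θ^L in ϖ and Q^α.

The pull-back commutes with d because the anchor preserves brackets (`anchor_brA`): under θ^R this
is the Maurer–Cartan equation. It commutes with the contractions because the anchor sends x_A to x_G
(`anchor_genA`).

For ϖ itself, integration by parts gives ϖ(ξ, ζ) = ∫ ξ̇·ζ - ξ_0·θ^L(ζ) - ½ θ^L(ξ)·θ^L(ζ), with θ^L
pulled back to A (`InvForm.varpi_apply`). Then dϖ(ξ, ζ, χ) is the cyclic sum of a(ξ)ϖ(ζ, χ) - ϖ([ξ,
ζ]_A, χ) (`InvForm.der_varpi_sub`). All integrals in this sum are again total t-derivatives: twice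
that of [ξ, ζ]·χ, and those of the functions (a(ζ)ξ)·χ and their cyclic images. Replacing the values
at t = 1 by those at t = 0 leaves a polynomial expression in ξ_0, θ^L(a(ξ)) and their derivatives,
and ad-invariance collapses it to η (`boundary_identity`). The contraction with x_A needs no such
work, since x_A is constant in t (`InvForm.contract_genA_varpi`). -/

lemma mul_left_md (g h : G) : MDifferentiableAt I I (fun a : G => g * a) h :=
  (mul_left_smooth I g).mdifferentiableAt (by simp)

lemma mul_right_md (g h : G) : MDifferentiableAt I I (fun a : G => a * g) h :=
  (mul_right_smooth I g).mdifferentiableAt (by simp)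

lemma conj_md (k h : G) : MDifferentiableAt I I (fun a : G => k * a * k⁻¹) h :=
  ((mul_right_smooth I k⁻¹).comp (mul_left_smooth I k)).mdifferentiableAt (by simp)

lemma Ad_inv_Ad (g : G) (x : LieAlg I G) : Ad I g⁻¹ (Ad I g x) = x := by
  rw [← Ad_mul, inv_mul_cancel, Ad_one]; rfl

/-- Left translation by g⁻¹ followed by conjugation by g is right translation by g⁻¹. Every passage
between left- and right-invariant data below goes through this relation. -/
lemma Ad_thetaL (g : G) (v : TangentSpace I g) : Ad I g (thetaL I g v) = thetaR I g v := by
  have h := mfderiv_comp_apply_of_eq (x := g) (y := 1) (conj_md I g 1) (mul_left_md I g⁻¹ g)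
    (by simp) v
  have e : (fun a : G => g * a * g⁻¹) ∘ (fun a : G => g⁻¹ * a) = fun a => a * g⁻¹ := by
    ext; simp
  rw [e] at h
  exact h.symm

lemma rightField_Ad (g : G) (x : LieAlg I G) : rightField I g (Ad I g x) = leftField I g x :=
  rightField_Ad_aux I g x

lemma thetaR_leftField (g : G) (x : LieAlg I G) : thetaR I g (leftField I g x) = Ad I g x := by
  rw [← rightField_Ad, thetaR_rightField]

lemma thetaL_leftField (g : G) (x : LieAlg I G) : thetaL I g (leftField I g x) = x := by
  rw [← Ad_inv_Ad I g (thetaL I g _), Ad_thetaL, thetaR_leftField, Ad_inv_Ad]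

/-- Together with `thetaR_rightField` this makes θ^R a trivialisation of the tangent bundle. -/
lemma rightField_thetaR (g : G) (v : TangentSpace I g) : rightField I g (thetaR I g v) = v := by
  have h := mfderiv_comp_apply_of_eq (x := g) (y := 1) (mul_right_md I g 1) (mul_right_md I g⁻¹ g)
    (by simp) v
  have e : (fun a : G => a * g) ∘ (fun a : G => a * g⁻¹) = id := by ext; simp
  rw [e] at h
  exact h.symm.trans (congrArg (fun T : E →L[ℝ] E => T v) (mfderiv_id (I := I) (x := g)))

lemma leftField_thetaL (g : G) (v : TangentSpace I g) : leftField I g (thetaL I g v) = v := by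
  rw [← rightField_Ad, Ad_thetaL, rightField_thetaR]

/-- Conjugation by k is a homomorphism, so it carries right translation by h to right translation by
khk⁻¹; the chain rule at the unit gives the rest. -/
lemma mfderiv_conj_rightField (k h : G) (x : LieAlg I G) :
    (mfderiv I I (fun a : G => k * a * k⁻¹) h : E →L[ℝ] E) (rightField I h x) =
      (rightField I (k * h * k⁻¹) (Ad I k x) : E) := by
  have h1 := mfderiv_comp_apply_of_eq (x := (1 : G)) (y := h) (conj_md I k h) (mul_right_md I h 1)
    (by simp) x
  have h2 := mfderiv_comp_apply_of_eq (x := (1 : G)) (y := 1) (mul_right_md I (k * h * k⁻¹) 1)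
    (conj_md I k 1) (by simp) x
  have e : (fun a : G => k * a * k⁻¹) ∘ (fun a : G => a * h) =
      (fun a : G => a * (k * h * k⁻¹)) ∘ (fun a : G => k * a * k⁻¹) := by
    ext; simp [mul_assoc]
  rw [e] at h1
  exact h1.symm.trans h2

end Translations

/-! ### Derivatives in charts and the product rule -/

section Charts
variable {V W U : Type*} [NormedAddCommGroup V] [NormedSpace ℝ V]
  [NormedAddCommGroup W] [NormedSpace ℝ W] [NormedAddCommGroup U] [NormedSpace ℝ U]

lemma mvfderiv_eq_fderiv_chart (f : G → V) (g : G) (hf : MDifferentiableAt I 𝓘(ℝ, V) f g)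
    (v : TangentSpace I g) :
    mvfderiv I f g v = fderiv ℝ (f ∘ (extChartAt I g).symm) (extChartAt I g g) v := by
  have h : (mfderiv I 𝓘(ℝ, V) f g : E →L[ℝ] V) =
      fderiv ℝ (f ∘ (extChartAt I g).symm) (extChartAt I g g) := by
    refine hf.mfderiv.trans ?_
    rw [I.range_eq_univ, fderivWithin_univ]
    rfl
  exact congrArg (fun T : E →L[ℝ] V => T v) h

lemma differentiableAt_chart {f : G → V} {g : G} (hf : MDifferentiableAt I 𝓘(ℝ, V) f g) :
    DifferentiableAt ℝ (f ∘ (extChartAt I g).symm) (extChartAt I g g) := by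
  have := hf.differentiableWithinAt_writtenInExtChartAt
  rwa [I.range_eq_univ, differentiableWithinAt_univ] at this

/-- The product rule for a continuous bilinear map. -/
lemma mvfderiv_bilin (b : V →L[ℝ] W →L[ℝ] U) (f : G → V) (h : G → W) (g : G)
    (hf : MDifferentiableAt I 𝓘(ℝ, V) f g) (hh : MDifferentiableAt I 𝓘(ℝ, W) h g)
    (v : TangentSpace I g) :
    mvfderiv I (fun a => b (f a) (h a)) g v =
      b (f g) (mvfderiv I h g v) + b (mvfderiv I f g v) (h g) := by
  have hb : MDifferentiableAt I 𝓘(ℝ, U) (fun a => b (f a) (h a)) g :=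
    (((b.contDiff (n := 1)).contMDiff.mdifferentiableAt (by simp)).comp g hf).clm_apply hh
  rw [mvfderiv_eq_fderiv_chart I _ g hb, mvfderiv_eq_fderiv_chart I _ g hf,
    mvfderiv_eq_fderiv_chart I _ g hh]
  have := b.fderiv_of_bilinear (differentiableAt_chart I hf) (differentiableAt_chart I hh)
  refine (congrArg (fun T : E →L[ℝ] U => T v) this).trans ?_
  -- The Euclidean product rule evaluates the chart representatives at the image of g, which the
  -- inverse chart sends back to g.
  change b (f ((extChartAt I g).symm (extChartAt I g g))) _ +
    b _ (h ((extChartAt I g).symm (extChartAt I g g))) = _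
  rw [extChartAt_to_inv]
  rfl

end Charts

/-! ### Infinitesimal invariance of the form, and equivariance of the anchor -/

section Equivariance
variable [FiniteDimensional ℝ E]

/-- The function h ↦ (Ad_h y)·(Ad_h z) is constant by Ad-invariance; its derivative at the unit in
the direction x is the sum of the two terms. -/
lemma ad_invariant (B : InvForm I G) (x y z : LieAlg I G) :
    B.form ⁅x, y⁆ z = -B.form y ⁅x, z⁆ := by
  have hs (w : LieAlg I G) : MDifferentiableAt I 𝓘(ℝ, LieAlg I G) (fun h : G => Ad I h w) 1 :=
    (smooth_Ad_const I w).mdifferentiableAt (by simp)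
  have h := mvfderiv_bilin I B.clm (fun h : G => Ad I h y) (fun h : G => Ad I h z) 1 (hs y) (hs z) x
  have e : (fun h : G => B.clm (Ad I h y) (Ad I h z)) = fun _ => B.form y z :=
    funext fun h => B.inv h y z
  rw [e, mvfderiv_const, mvfderiv_Ad, mvfderiv_Ad, Ad_one] at h
  have h' : (0 : ℝ) = B.form y ⁅x, z⁆ + B.form ⁅x, y⁆ z := h
  linarith

lemma rightVF_thetaRForm (X : VF I G) : rightVF I (thetaRForm I X) = X := by
  ext g; exact rightField_thetaR I g (X g)

lemma AdFn_thetaLForm (X : VF I G) : AdFn I (thetaLForm I X) = thetaRForm I X := by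
  ext g; exact Ad_thetaL I g (X g)

/-- Lets identities between vector fields be checked on 𝔤-valued functions; the anchor is itself
defined through θ^R. -/
lemma thetaRForm_injective : Function.Injective (thetaRForm I (G := G)) :=
  Function.LeftInverse.injective (rightVF_thetaRForm I)

lemma thetaRForm_anchor (x : secA I G) : thetaRForm I (anchor I G x) = twist I (x : LiePath I G) :=
  thetaRForm_rightVF I _

lemma thetaRForm_actVF (k : G) (X : VF I G) (g : G) :
    thetaRForm I (actVF k X) g = Ad I k (thetaRForm I X (k⁻¹ * g * k)) := by
  have h := mfderiv_conj_rightField I k (k⁻¹ * g * k) (thetaRForm I X (k⁻¹ * g * k))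
  have e : k * (k⁻¹ * g * k) * k⁻¹ = g := by group
  rw [e] at h
  have h1 : actVF k X g = rightField I g (Ad I k (thetaRForm I X (k⁻¹ * g * k))) := by
    refine Eq.trans ?_ h
    exact congrArg (mfderiv I I (fun a : G => k * a * k⁻¹) (k⁻¹ * g * k) : E →L[ℝ] E)
      (rightField_thetaR I _ (X (k⁻¹ * g * k))).symm
  exact (congrArg (thetaR I g) h1).trans (thetaR_rightField I g _)

lemma thetaLForm_actVF (k : G) (X : VF I G) (g : G) :
    thetaLForm I (actVF k X) g = Ad I k (thetaLForm I X (k⁻¹ * g * k)) := by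
  have h := thetaRForm_actVF I k X g
  rw [← AdFn_thetaLForm, ← AdFn_thetaLForm, AdFn_apply, AdFn_apply] at h
  -- Write θ^L as Ad_{g⁻¹} θ^R; the claim becomes the relation g⁻¹k(k⁻¹gk) = k.
  rw [← Ad_inv_Ad I g (thetaLForm I _ g), h, ← Ad_mul, ← Ad_mul]
  congr 2
  group

lemma actA_periodic (k : G) (x : secA I G) (g : G) (t : ℝ) :
    actPath k (x : LiePath I G) (g, t + 1) = Ad I g (actPath k (x : LiePath I G) (g, t)) +
      Ad I k (twist I (x : LiePath I G) (k⁻¹ * g * k)) := by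
  have h := secA_periodic I x.2 (k⁻¹ * g * k) t
  change Ad I k (x.1 (k⁻¹ * g * k, t + 1)) = Ad I g (Ad I k (x.1 (k⁻¹ * g * k, t))) + _
  rw [h, map_add, ← Ad_mul, ← Ad_mul]
  congr 3
  group

/-- The action transforms the twist v_ξ exactly as conjugation transforms θ^R of a vector field, so
this is checked under θ^R. It makes the pull-back by the anchor preserve invariance. -/
lemma anchor_actA (k : G) (x : secA I G) : anchor I G (actA k x) = actVF k (anchor I G x) := by
  apply thetaRForm_injective
  ext g
  rw [thetaRForm_actVF, thetaRForm_anchor, thetaRForm_anchor, twist_apply]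
  have h := actA_periodic I k x g 0
  rw [zero_add] at h
  exact sub_eq_of_eq_add' h

/-- The constant path -x has twist -x + Ad_g x, which is θ^R(x^L - x^R). This is what matches the
contractions in the two equivariant differentials. -/
lemma anchor_genA (x : LieAlg I G) : anchor I G (genA I G x) = genG I G x := by
  apply thetaRForm_injective
  rw [thetaRForm_anchor]
  ext g
  have h : thetaRForm I (genG I G x) g =
      thetaR I g (leftField I g x) - thetaR I g (rightField I g x) :=
    map_sub (thetaR I g) (leftField I g x) (rightField I g x)
  rw [h, thetaR_leftField, thetaR_rightField, twist_apply]
  change -x - Ad I g (-x) = _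
  rw [map_neg]; abel

end Equivariance
-- The Maurer–Cartan equation and the anchor as a bracket homomorphism
section MaurerCartan
variable [FiniteDimensional ℝ E]

/-- The vector field `X` with `θ^L(X) = v`. -/
def leftVF : LieFn I G →ₗ[Fn I G] VF I G := rightVF I ∘ₗ AdFn I

lemma leftVF_apply (v : LieFn I G) (g : G) : leftVF I v g = leftField I g (v g) :=
  rightField_Ad I g (v g)

lemma leftVF_thetaLForm (X : VF I G) : leftVF I (thetaLForm I X) = X := by
  ext g; exact (leftVF_apply I _ g).trans (leftField_thetaL I g (X g))

lemma thetaLForm_leftVF (v : LieFn I G) : thetaLForm I (leftVF I v) = v := by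
  ext g; exact (congrArg (thetaL I g) (leftVF_apply I v g)).trans (thetaL_leftField I g _)

/-- The bracket of 𝔤 is by definition that of left-invariant fields, and these are the
left-invariant fields. It is the case of constant functions in `thetaLForm_brVF`. -/
lemma brVF_leftVF_const (x y : LieAlg I G) :
    brVF I G (leftVF I (constLie I G x)) (leftVF I (constLie I G y)) =
      leftVF I (constLie I G ⁅x, y⁆) := by
  have : CompleteSpace E := FiniteDimensional.complete ℝ E
  have : LieGroup I (minSmoothness ℝ 3) G := by
    rw [minSmoothness_of_isRCLikeNormedField]; infer_instance
  ext g
  have e (z : LieAlg I G) : (fun g => leftVF I (constLie I G z) g) =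
      mulInvariantVectorField (I := I) (G := G) z := funext fun g => leftVF_apply I _ g
  have h := congrFun (mulInvariantVector_mlieBracket (I := I) (G := G) x y) g
  refine Eq.trans ?_ (h.symm.trans (congrFun (e ⁅x, y⁆) g).symm)
  rw [← e x, ← e y]
  rfl

lemma brVF_smul (X Y : VF I G) (f : Fn I G) :
    brVF I G X (f • Y) = f • brVF I G X Y + derFn I X f • Y := (algT I).br_smul X f Y

lemma smul_brVF (X Y : VF I G) (f : Fn I G) :
    brVF I G (f • X) Y = f • brVF I G X Y - derFn I Y f • X := (algT I).smul_br f X Y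

lemma brVF_skew (X Y : VF I G) : brVF I G Y X = -brVF I G X Y := (algT I).br_skew X Y

lemma add_brVF (X Y Z : VF I G) : brVF I G (X + Y) Z = brVF I G X Z + brVF I G Y Z :=
  (algT I).add_br X Y Z

lemma brVF_add (X Y Z : VF I G) : brVF I G X (Y + Z) = brVF I G X Y + brVF I G X Z := by
  rw [brVF_skew, add_brVF, neg_add, ← brVF_skew, ← brVF_skew]

lemma derLie_const (X : VF I G) (x : LieAlg I G) : derLie I X (constLie I G x) = 0 := by
  ext g
  exact congrArg (fun T : TangentSpace I g →L[ℝ] LieAlg I G => T (X g)) (mvfderiv_const (c := x))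

lemma derLie_add_left (X Y : VF I G) (v : LieFn I G) :
    derLie I (X + Y) v = derLie I X v + derLie I Y v := by
  ext g; exact map_add (mvfderiv I v g) (X g) (Y g)

/-- Functions with values in `𝔤` are generated by the constant ones. -/
lemma lieFn_induction {p : LieFn I G → Prop} (h0 : p 0) (hadd : ∀ v w, p v → p w → p (v + w))
    (hsmul : ∀ (f : Fn I G) (x : LieAlg I G), p (f • constLie I G x)) (v : LieFn I G) : p v := by
  let b := Module.finBasis ℝ (LieAlg I G)
  let f (i) : Fn I G := ⟨fun g => b.repr (v g) i,
    (LinearMap.toContinuousLinearMap (b.coord i)).contDiff.contMDiff.comp v.contMDiff⟩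
  -- Coordinates in a basis of 𝔤 are linear, hence smooth functions of g.
  have e : v = ∑ i, f i • constLie I G (b i) := by
    ext g
    have h1 : (∑ i, f i • constLie I G (b i)) g = ∑ i, (f i • constLie I G (b i)) g :=
      map_sum ({ toFun := fun w => w g, map_zero' := rfl, map_add' := fun _ _ => rfl } :
        LieFn I G →+ LieAlg I G) _ _
    rw [h1]
    exact (b.sum_repr (v g)).symm
  rw [e]
  exact Finset.sum_induction _ p hadd h0 fun i _ => hsmul _ _

/-- The Maurer--Cartan equation for `θ^L`. -/
lemma thetaLForm_brVF (X Y : VF I G) :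
    thetaLForm I (brVF I G X Y) = derLie I X (thetaLForm I Y) - derLie I Y (thetaLForm I X) +
      lieFn I G (thetaLForm I X) (thetaLForm I Y) := by
  -- Every vector field is `leftVF` of its θ^L. Both sides are biadditive and satisfy the same
  -- Leibniz rule in each argument, so constant v and w suffice.
  suffices h : ∀ v w : LieFn I G, thetaLForm I (brVF I G (leftVF I v) (leftVF I w)) =
      derLie I (leftVF I v) w - derLie I (leftVF I w) v + lieFn I G v w by
    have := h (thetaLForm I X) (thetaLForm I Y)
    rwa [leftVF_thetaLForm, leftVF_thetaLForm] at this
  have hc : ∀ x y : LieAlg I G, lieFn I G (constLie I G x) (constLie I G y) =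
      constLie I G ⁅x, y⁆ := fun x y => rfl
  have hz : ∀ Z : VF I G, brVF I G 0 Z = 0 := fun Z => by
    have := add_brVF I 0 0 Z
    rw [add_zero] at this
    exact left_eq_add.1 this
  have hz' : ∀ Z : VF I G, brVF I G Z 0 = 0 := fun Z => by rw [brVF_skew, hz, neg_zero]
  intro v w
  refine lieFn_induction I (p := fun v => thetaLForm I (brVF I G (leftVF I v) (leftVF I w)) =
      derLie I (leftVF I v) w - derLie I (leftVF I w) v + lieFn I G v w) ?_ ?_ ?_ v
  · simp only [map_zero, hz, derLie_zero, derLie_zero_left, LinearMap.zero_apply]; abel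
  · intro v v' h h'
    simp only [map_add, add_brVF, derLie_add, derLie_add_left, LinearMap.add_apply, h, h']; abel
  intro f x
  refine lieFn_induction I (p := fun w =>
      thetaLForm I (brVF I G (leftVF I (f • constLie I G x)) (leftVF I w)) =
      derLie I (leftVF I (f • constLie I G x)) w - derLie I (leftVF I w) (f • constLie I G x) +
        lieFn I G (f • constLie I G x) w) ?_ ?_ ?_ w
  · simp only [map_zero, hz', derLie_zero, derLie_zero_left]; abel
  · intro w w' h h'
    simp only [map_add, brVF_add, derLie_add, derLie_add_left, h, h']; abel
  intro f' y
  simp only [map_smul, brVF_smul, smul_brVF, derLie_smul, map_add, map_sub,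
    brVF_leftVF_const, thetaLForm_leftVF, derLie_const, LinearMap.smul_apply, hc, smul_zero,
    zero_add]
  have hd : derFn I (f • leftVF I (constLie I G x)) f' =
      f * derFn I (leftVF I (constLie I G x)) f' := by
    ext g; exact map_smul (mvfderiv I f' g) (f g) (leftVF I (constLie I G x) g)
  have hd' : derFn I (f' • leftVF I (constLie I G y)) f =
      f' * derFn I (leftVF I (constLie I G y)) f := by
    ext g; exact map_smul (mvfderiv I f g) (f' g) (leftVF I (constLie I G y) g)
  -- The terms with a differentiated coefficient, f·X(f') y and f'·Y(f) x, occur identically on both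
  -- sides; the remainder is the bracket of constants.
  simp only [hd, hd', mul_smul, smul_sub, smul_comm f' f (constLie I G ⁅x, y⁆)]
  abel

/-- The derivative of `Ad_g v(g)`. -/
lemma derLie_AdFn (X : VF I G) (v : LieFn I G) :
    derLie I X (AdFn I v) = AdFn I (lieFn I G (thetaLForm I X) v + derLie I X v) := by
  ext g
  -- That formula is stated along right-invariant directions, so X is written at g as the right
  -- field of θ^R(X).
  have h := mvfderiv_Ad_fun I v v.contMDiff g (thetaR I g (X g))
  rw [rightField_thetaR] at h
  refine h.trans ?_
  rw [AdFn_apply, ← Ad_thetaL, ← Ad_lie, ← map_add]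
  rfl

/-- Follows from the equation for θ^L through θ^R = Ad_g θ^L. Differentiating Ad_g contributes the
bracket once from each derivative term, which turns the coefficient -1 into +1. -/
lemma thetaRForm_brVF (X Y : VF I G) :
    thetaRForm I (brVF I G X Y) = -lieFn I G (thetaRForm I X) (thetaRForm I Y) +
      derLie I X (thetaRForm I Y) - derLie I Y (thetaRForm I X) := by
  have hA (v w : LieFn I G) : lieFn I G (AdFn I v) (AdFn I w) = AdFn I (lieFn I G v w) := by
    ext g; exact (Ad_lie I g _ _).symm
  have hs : lieFn I G (thetaLForm I Y) (thetaLForm I X) =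
      -lieFn I G (thetaLForm I X) (thetaLForm I Y) := by
    ext g; exact (lie_skew _ _).symm
  rw [← AdFn_thetaLForm, ← AdFn_thetaLForm, ← AdFn_thetaLForm, derLie_AdFn, derLie_AdFn, hA,
    thetaLForm_brVF, ← map_neg, ← map_add, ← map_sub, hs]
  congr 1
  abel

/-- The twist of [ξ, ζ]_A, computed in `brPath_periodic`, is literally the right-hand side of the
Maurer–Cartan equation for θ^R. -/
lemma anchor_brA (x y : secA I G) :
    anchor I G (brA I G x y) = brVF I G (anchor I G x) (anchor I G y) := by
  apply thetaRForm_injective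
  rw [thetaRForm_brVF, thetaRForm_anchor, thetaRForm_anchor, thetaRForm_anchor]
  exact twist_eq I (brPath_periodic I x.2 y.2)

variable {I} in
-- The differential is built from the anchor and the bracket alone, and `anchor_brA` says that the
-- anchor respects both.
lemma dA2_pullA (om : (VF I G) [⋀^Fin 2]→ₗ[Fn I G] (Fn I G)) :
    dA2 I G (pullA om) = pullA (dG2 I G om) := by
  have h (x y : secA I G) : pullA om ![x, y] = om ![anchor I G x, anchor I G y] := by
    refine congrArg om (funext fun i => ?_)
    fin_cases i <;> rfl
  ext1 v
  change vfDer I G (anchor I G (v 0)) (pullA om ![v 1, v 2]) -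
      vfDer I G (anchor I G (v 1)) (pullA om ![v 0, v 2]) +
      vfDer I G (anchor I G (v 2)) (pullA om ![v 0, v 1]) -
      pullA om ![brA I G (v 0) (v 1), v 2] + pullA om ![brA I G (v 0) (v 2), v 1] -
      pullA om ![brA I G (v 1) (v 2), v 0] = _
  simp only [h, anchor_brA]
  rfl

end MaurerCartan
end

/-! ### Mixed partial derivatives and differentiation under the integral sign -/

section VectorCalculus
variable {E V : Type*} [NormedAddCommGroup E] [NormedSpace ℝ E]
  [NormedAddCommGroup V] [NormedSpace ℝ V]

lemma contDiffAt_of_prod_univ {F : E × ℝ → V} {U : Set E} (hU : IsOpen U)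
    (hF : ContDiffOn ℝ ∞ F (U ×ˢ univ)) {e : E} (he : e ∈ U) (t : ℝ) : ContDiffAt ℝ ∞ F (e, t) :=
  hF.contDiffAt ((hU.prod isOpen_univ).mem_nhds ⟨he, trivial⟩)

lemma hasFDerivAt_partial_left {F : E × ℝ → V} {e : E} {t : ℝ}
    (hF : DifferentiableAt ℝ F (e, t)) :
    HasFDerivAt (fun a => F (a, t)) ((fderiv ℝ F (e, t)).comp (ContinuousLinearMap.inl ℝ E ℝ)) e :=
  HasFDerivAt.comp (g := F) (f := fun a => (a, t)) e hF.hasFDerivAt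
    ((hasFDerivAt_id e).prodMk (hasFDerivAt_const t e))

lemma hasDerivAt_partial_right {F : E × ℝ → V} {e : E} {t : ℝ}
    (hF : DifferentiableAt ℝ F (e, t)) :
    HasDerivAt (fun s => F (e, s)) (fderiv ℝ F (e, t) (0, 1)) t :=
  HasFDerivAt.comp_hasDerivAt (l := F) (f := fun s => (e, s)) t hF.hasFDerivAt
    ((hasDerivAt_const t e).prodMk (hasDerivAt_id t))

/-- Partial derivatives commute. -/
lemma deriv_fderiv_comm {F : E × ℝ → V} {U : Set E} (hU : IsOpen U)
    (hF : ContDiffOn ℝ ∞ F (U ×ˢ univ)) {e : E} (he : e ∈ U) (t : ℝ) (v : E) :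
    deriv (fun s => fderiv ℝ (fun a => F (a, s)) e v) t =
      fderiv ℝ (fun a => deriv (fun s => F (a, s)) t) e v := by
  have hd {a : E} (ha : a ∈ U) (s : ℝ) : DifferentiableAt ℝ F (a, s) :=
    (contDiffAt_of_prod_univ hU hF ha s).differentiableAt (by simp)
  have h2 : DifferentiableAt ℝ (fderiv ℝ F) (e, t) :=
    ((contDiffAt_of_prod_univ hU hF he t).fderiv_right (m := ∞) (by simp)).differentiableAt (by simp)
  have e1 : (fun s => fderiv ℝ (fun a => F (a, s)) e v) = fun s => fderiv ℝ F (e, s) (v, 0) := by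
    funext s
    rw [(hasFDerivAt_partial_left (hd he s)).fderiv]
    rfl
  -- An equality of germs at e is enough, since it is differentiated in a; smoothness of F is only
  -- available over U.
  have e2 : (fun a => deriv (fun s => F (a, s)) t) =ᶠ[𝓝 e] fun a => fderiv ℝ F (a, t) (0, 1) := by
    filter_upwards [hU.mem_nhds he] with a ha using (hasDerivAt_partial_right (hd ha t)).deriv
  have h3 : HasDerivAt (fun s => fderiv ℝ F (e, s) (v, 0))
      (fderiv ℝ (fderiv ℝ F) (e, t) (0, 1) (v, 0)) t := by
    simpa using (hasDerivAt_partial_right h2).clm_apply (hasDerivAt_const t ((v, 0) : E × ℝ))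
  have h4 := (hasFDerivAt_partial_left h2).clm_apply (hasFDerivAt_const ((0, 1) : E × ℝ) e)
  rw [e1, e2.fderiv_eq, h3.deriv, h4.fderiv]
  -- Both sides are now second derivatives of F in the directions (0, 1) and (v, 0), in opposite
  -- orders.
  have h5 := (contDiffAt_of_prod_univ hU hF he t).isSymmSndFDerivAt (by
    simp only [minSmoothness_of_isRCLikeNormedField]; exact ENat.LEInfty.out)
  simpa using h5 (0, 1) (v, 0)

/-- Differentiation under the integral sign. -/
lemma fderiv_integral [FiniteDimensional ℝ E] {F : E × ℝ → ℝ} {U : Set E} (hU : IsOpen U)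
    (hF : ContDiffOn ℝ ∞ F (U ×ˢ univ)) {e : E} (he : e ∈ U) (v : E) :
    fderiv ℝ (fun a => ∫ t in (0 : ℝ)..1, F (a, t)) e v =
      ∫ t in (0 : ℝ)..1, fderiv ℝ (fun a => F (a, t)) e v := by
  have hd {a : E} (ha : a ∈ U) (s : ℝ) : DifferentiableAt ℝ F (a, s) :=
    (contDiffAt_of_prod_univ hU hF ha s).differentiableAt (by simp)
  let F' (a : E) (t : ℝ) : E →L[ℝ] ℝ := (fderiv ℝ F (a, t)).comp (ContinuousLinearMap.inl ℝ E ℝ)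
  have hc : ContinuousOn (fun p : E × ℝ => F' p.1 p.2) (U ×ˢ univ) :=
    (hF.continuousOn_fderiv_of_isOpen (hU.prod isOpen_univ) (by simp)).clm_comp continuousOn_const
  have hl {a : E} (ha : a ∈ U) : Continuous fun t => F (a, t) :=
    hF.continuousOn.comp_continuous (Continuous.prodMk_right a) fun t => ⟨ha, trivial⟩
  have hl' : Continuous (F' e) :=
    hc.comp_continuous (Continuous.prodMk_right e) fun t => ⟨he, trivial⟩
  -- In finite dimension the closed ball is compact, so the partial derivative is bounded on ball ×
  -- [0, 1]; this constant is the dominating function.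
  obtain ⟨r, hr, hrU⟩ := Metric.nhds_basis_closedBall.mem_iff.1 (hU.mem_nhds he)
  have hK := (isCompact_closedBall e r).prod (isCompact_Icc (a := (0 : ℝ)) (b := 1))
  obtain ⟨C, hC⟩ := hK.exists_bound_of_continuousOn (hc.mono (prod_mono hrU (subset_univ _)))
  have key := intervalIntegral.hasFDerivAt_integral_of_dominated_of_fderiv_le
    (μ := MeasureTheory.volume) (a := 0) (b := 1) (F := fun a t => F (a, t)) (F' := F') (x₀ := e)
    (bound := fun _ => C) (Metric.closedBall_mem_nhds e hr)
    (Filter.mem_of_superset (hU.mem_nhds he) fun a ha =>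
      (hl ha).aestronglyMeasurable)
    ((hl he).intervalIntegrable 0 1)
    hl'.aestronglyMeasurable
    (Filter.Eventually.of_forall fun t ht a ha => hC (a, t) ⟨ha, by
      rw [uIoc_of_le zero_le_one] at ht
      exact ⟨ht.1.le, ht.2⟩⟩)
    intervalIntegrable_const
    (Filter.Eventually.of_forall fun t _ a ha => hasFDerivAt_partial_left (hd (hrU ha) t))
  rw [key.fderiv, ContinuousLinearMap.intervalIntegral_apply (hl'.intervalIntegrable 0 1)]
  refine intervalIntegral.integral_congr fun t _ => ?_
  exact congrArg (fun T : E →L[ℝ] ℝ => T v) (hasFDerivAt_partial_left (hd he t)).fderiv.symm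

end VectorCalculus

/-! ### Calculus of paths: time derivatives, pairings and integration by parts -/

section
variable {E : Type*} [NormedAddCommGroup E] [NormedSpace ℝ E]
  {H : Type*} [TopologicalSpace H] (I : ModelWithCorners ℝ E H) [I.Boundaryless]
  {G : Type*} [TopologicalSpace G] [ChartedSpace H G] [Group G] [LieGroup I ∞ G]
  [FiniteDimensional ℝ E]

/-- Only the G-variable is put in a chart; time stays global, as the lemmas over U × ℝ and the
integral over [0, 1] require. -/
lemma contDiffOn_chart {V : Type*} [NormedAddCommGroup V] [NormedSpace ℝ V] {f : G × ℝ → V}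
    (hf : ContMDiff (I.prod 𝓘(ℝ, ℝ)) 𝓘(ℝ, V) ∞ f) (g : G) :
    ContDiffOn ℝ ∞ (fun q : E × ℝ => f ((extChartAt I g).symm q.1, q.2))
      ((extChartAt I g).target ×ˢ univ) := by
  rw [← contMDiffOn_iff_contDiffOn]
  refine hf.comp_contMDiffOn ?_
  refine ContMDiffOn.prodMk ?_ contDiff_snd.contMDiff.contMDiffOn
  exact (contMDiffOn_extChartAt_symm g).comp contDiff_fst.contMDiff.contMDiffOn
    (fun q hq => hq.1)

lemma md_slice {V : Type*} [NormedAddCommGroup V] [NormedSpace ℝ V] {f : G × ℝ → V}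
    (hf : ContMDiff (I.prod 𝓘(ℝ, ℝ)) 𝓘(ℝ, V) ∞ f) (g : G) (t : ℝ) :
    MDifferentiableAt I 𝓘(ℝ, V) (fun h => f (h, t)) g :=
  (hf.comp (contMDiff_id.prodMk contMDiff_const)).mdifferentiableAt (by simp)

/-- Symmetry of mixed partial derivatives, read in a chart centred at g. It is needed to compute the
time derivative of [ξ, ζ]_A. -/
lemma timeDeriv_derPath (X : VF I G) (x : LiePath I G) :
    timeDeriv I G (derPath I X x) = derPath I X (timeDeriv I G x) := by
  ext ⟨g, t⟩
  have h := deriv_fderiv_comm (isOpen_extChartAt_target (I := I) g)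
    (contDiffOn_chart I x.contMDiff g) (mem_extChartAt_target (I := I) g) t (X g)
  have e1 : (fun s => derPath I X x (g, s)) = fun s =>
      fderiv ℝ (fun a => x ((extChartAt I g).symm a, s)) (extChartAt I g g) (X g) :=
    funext fun s => mvfderiv_eq_fderiv_chart I _ g (md_slice I x.contMDiff g s) (X g)
  have e2 := mvfderiv_eq_fderiv_chart I _ g (md_slice I (timeDeriv I G x).contMDiff g t) (X g)
  refine Eq.trans ?_ (h.trans e2.symm)
  exact congrArg (fun u : ℝ → LieAlg I G => deriv u t) e1

lemma mvfderiv_integral {f : G × ℝ → ℝ} (hf : ContMDiff (I.prod 𝓘(ℝ, ℝ)) 𝓘(ℝ, ℝ) ∞ f) (g : G)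
    (v : TangentSpace I g) :
    mvfderiv I (fun h => ∫ t in (0 : ℝ)..1, f (h, t)) g v =
      ∫ t in (0 : ℝ)..1, mvfderiv I (fun h => f (h, t)) g v := by
  have h := fderiv_integral (isOpen_extChartAt_target (I := I) g) (contDiffOn_chart I hf g)
    (mem_extChartAt_target (I := I) g) v
  rw [mvfderiv_eq_fderiv_chart I _ g ((smooth_integral I f hf).mdifferentiableAt (by simp))]
  refine h.trans (intervalIntegral.integral_congr fun t _ => ?_)
  exact (mvfderiv_eq_fderiv_chart I _ g (md_slice I hf g t) v).symm

variable {I}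

lemma InvForm.derFn_pair (B : InvForm I G) (X : VF I G) (v w : LieFn I G) :
    derFn I X (B.pair v w) = B.pair (derLie I X v) w + B.pair v (derLie I X w) := by
  ext g
  exact (mvfderiv_bilin I B.clm v w g (lieFn_md I v g) (lieFn_md I w g) (X g)).trans (add_comm _ _)

/-- Differentiation under the integral sign, followed by the product rule for `pair` at each fixed
time. -/
lemma InvForm.derFn_intPair (B : InvForm I G) (X : VF I G) (x y : LiePath I G) :
    derFn I X (B.intPair x y) = B.intPair (derPath I X x) y + B.intPair x (derPath I X y) := by
  ext g
  refine (mvfderiv_integral I (B.smooth_path x y) g (X g)).trans ?_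
  refine Eq.trans (intervalIntegral.integral_congr fun t _ => ?_)
    (intervalIntegral.integral_add (B.int_path (derPath I X x) y g)
      (B.int_path x (derPath I X y) g))
  exact DFunLike.congr_fun (B.derFn_pair X (evalAt I t x) (evalAt I t y)) g

lemma InvForm.pair_comm (B : InvForm I G) (x y : LieFn I G) : B.pair x y = B.pair y x := by
  ext g; exact B.symm _ _

lemma InvForm.pair_AdFn (B : InvForm I G) (x y : LieFn I G) :
    B.pair (AdFn I x) (AdFn I y) = B.pair x y := by
  ext g; exact B.inv g _ _

lemma InvForm.intPair_comm (B : InvForm I G) (x y : LiePath I G) :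
    B.intPair x y = B.intPair y x := by
  ext g; exact intervalIntegral.integral_congr fun t _ => B.symm _ _

lemma hasDerivAt_path (x : LiePath I G) (g : G) (t : ℝ) :
    HasDerivAt (fun s => x (g, s)) (timeDeriv I G x (g, t)) t :=
  (((path_contDiff I x g).differentiable (by simp)) t).hasDerivAt

/-- Integration by parts. -/
lemma InvForm.intPair_timeDeriv (B : InvForm I G) (x y : LiePath I G) :
    B.intPair (timeDeriv I G x) y + B.intPair x (timeDeriv I G y) =
      B.pair (evalAt I 1 x) (evalAt I 1 y) - B.pair (evalAt I 0 x) (evalAt I 0 y) := by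
  ext g
  have hd (t : ℝ) : HasDerivAt (fun s => B.form (x (g, s)) (y (g, s)))
      (B.form (timeDeriv I G x (g, t)) (y (g, t)) + B.form (x (g, t)) (timeDeriv I G y (g, t))) t :=
    ((B.clm.hasFDerivAt.comp_hasDerivAt t (hasDerivAt_path x g t)).clm_apply
      (hasDerivAt_path y g t))
  refine (intervalIntegral.integral_add (B.int_path (timeDeriv I G x) y g)
    (B.int_path x (timeDeriv I G y) g)).symm.trans ?_
  exact intervalIntegral.integral_eq_sub_of_hasDerivAt (fun t _ => hd t)
    ((B.int_path (timeDeriv I G x) y g).add (B.int_path x (timeDeriv I G y) g))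

lemma timeDeriv_liePath (x y : LiePath I G) :
    timeDeriv I G (liePath I G x y) =
      liePath I G (timeDeriv I G x) y + liePath I G x (timeDeriv I G y) := by
  ext ⟨g, t⟩
  exact (((lieCLM I G).hasFDerivAt.comp_hasDerivAt t (hasDerivAt_path x g t)).clm_apply
      (hasDerivAt_path y g t)).deriv

end

/-! ### The decomposition of ϖ^α and the differential of ϖ -/

section
variable {E : Type*} [NormedAddCommGroup E] [NormedSpace ℝ E]
  {H : Type*} [TopologicalSpace H] {I : ModelWithCorners ℝ E H} [I.Boundaryless]
  {G : Type*} [TopologicalSpace G] [ChartedSpace H G] [Group G] [LieGroup I ∞ G]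
  [FiniteDimensional ℝ E]

lemma alt2_ext {R Γ V : Type*} [CommRing R] [AddCommGroup Γ] [Module R Γ] [AddCommGroup V]
    [Module R V] {om om' : Γ [⋀^Fin 2]→ₗ[R] V} (h : ∀ x y, om ![x, y] = om' ![x, y]) :
    om = om' := by
  ext1 v
  have hv : v = ![v 0, v 1] := by ext i; fin_cases i <;> rfl
  rw [hv, h]

lemma alt2_neg {R Γ V : Type*} [CommRing R] [AddCommGroup Γ] [Module R Γ] [AddCommGroup V]
    [Module R V] (om : Γ [⋀^Fin 2]→ₗ[R] V) (x y : Γ) : om ![-x, y] = -om ![x, y] := by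
  rw [← neg_one_smul R x, alt2_smul, neg_one_smul]

/-- The cancellation of the boundary terms in the differential of `ϖ`. -/
lemma boundary_identity {R V : Type*} [CommRing R] [Algebra ℝ R] [AddCommGroup V] [Module R V]
    (p : V →ₗ[R] V →ₗ[R] R) (l : V →ₗ[R] V →ₗ[R] V)
    (skew : ∀ u v w, p (l v u) w = -p (l u v) w) (cyc : ∀ u v w, p (l u v) w = p (l v w) u)
    (comm : ∀ u v, p u v = p v u) (x y z a b c dyx dya dzy dzb dxz dxc : V) :
    (2 : ℝ) • (p (l (x + a) (y + b)) (z + c) - p (l x y) z) +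
      (p (l b (x + a) + dyx + dya) (z + c) - p dyx z) +
      (p (l c (y + b) + dzy + dzb) (x + a) - p dzy x) +
      (p (l a (z + c) + dxz + dxc) (y + b) - p dxz y) -
      (p dxc y + (1 / 2 : ℝ) • p dxc b + p (l x y) c + p dyx c +
        (1 / 2 : ℝ) • p dya c - (1 / 2 : ℝ) • p (l a b) c) -
      (p dya z + (1 / 2 : ℝ) • p dya c + p (l y z) a + p dzy a +
        (1 / 2 : ℝ) • p dzb a - (1 / 2 : ℝ) • p (l b c) a) -
      (p dzb x + (1 / 2 : ℝ) • p dzb a + p (l z x) b + p dxz b +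
        (1 / 2 : ℝ) • p dxc b - (1 / 2 : ℝ) • p (l c a) b) =
    (1 / 12 : ℝ) • (p a (l b c - l c b) - p b (l a c - l c a) + p c (l a b - l b a)) := by
  have s1 : p (l b (x + a)) (z + c) = -p (l (x + a) b) (z + c) := skew _ _ _
  have s2 : p (l c (y + b)) (x + a) = -p (l (x + a) (y + b)) c := by rw [cyc, skew]
  have s3 : p (l a (z + c)) (y + b) = -p (l a (y + b)) (z + c) := by rw [skew, cyc]
  have s4 : p (l y z) a = p (l a y) z := (cyc _ _ _).symm
  have s5 : p (l z x) b = p (l x b) z := cyc _ _ _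
  have s6 : p (l b c) a = p (l a b) c := (cyc _ _ _).symm
  have s7 : p (l c a) b = p (l a b) c := cyc _ _ _
  -- The wedge product [θ^L, θ^L] evaluates to twice the bracket; with the three equal cyclic terms
  -- the factor 1/12 in η becomes 1/2.
  have e (u v w : V) : p u (l v w - l w v) = (2 : ℝ) • p (l u v) w := by
    rw [cyc u v w, comm, map_sub, LinearMap.sub_apply, skew v w]
    module
  have s8 : p (l b a) c = -p (l a b) c := skew _ _ _
  simp only [map_add, LinearMap.add_apply] at s1 s2 s3
  simp only [e, s8, s7, s4, s5, s6, map_add, LinearMap.add_apply]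
  -- The product p (l b a) c has already been rewritten by `s8` in the goal but still occurs in
  -- `s1`; subtracting `s8` compensates.
  linear_combination (norm := module) s1 + s2 + s3 - s8

lemma lieFn_skew (v w : LieFn I G) : lieFn I G w v = -lieFn I G v w := by
  ext g; exact (lie_skew _ _).symm

/-- Ad-invariance and symmetry of the form make (u, v, w) ↦ [u, v]·w totally antisymmetric. -/
lemma InvForm.pair_cyclic (B : InvForm I G) (u v w : LieFn I G) :
    B.pair (lieFn I G u v) w = B.pair (lieFn I G v w) u := by
  ext g
  have h := ad_invariant I B (v g) (u g) (w g)
  have h' := ad_invariant I B (u g) (v g) (w g)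
  change B.form ⁅u g, v g⁆ (w g) = B.form ⁅v g, w g⁆ (u g)
  rw [← lie_skew, map_neg, LinearMap.neg_apply, h, neg_neg, B.symm]

lemma InvForm.intPair_cyclic (B : InvForm I G) (x y z : LiePath I G) :
    B.intPair (liePath I G x y) z = B.intPair (liePath I G y z) x := by
  ext g
  exact intervalIntegral.integral_congr fun t _ =>
    DFunLike.congr_fun (B.pair_cyclic (evalAt I t x) (evalAt I t y) (evalAt I t z)) g

lemma AdFn_thetaLA (x : secA I G) : AdFn I (thetaLA I G x) = twist I (x : LiePath I G) :=
  (AdFn_thetaLForm I _).trans (thetaRForm_anchor I x)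

/-- Quasi-periodicity at t = 0, with v_ξ = θ^R(a(ξ)) moved inside Ad_g as θ^L. In this form
Ad-invariance of the form removes Ad_g from every boundary term at t = 1. -/
lemma evalAt_one (x : secA I G) :
    evalAt I 1 (x : LiePath I G) = AdFn I (evalAt I 0 (x : LiePath I G) + thetaLA I G x) := by
  rw [map_add, AdFn_thetaLA]
  exact (add_sub_cancel _ _).symm

lemma AdFn_lieFn (v w : LieFn I G) : AdFn I (lieFn I G v w) = lieFn I G (AdFn I v) (AdFn I w) := by
  ext g; exact Ad_lie I g _ _

/-- Integration by parts moves all time derivatives onto the first argument, and part of the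
boundary term cancels half of the θ^L·κ_0 terms. Antisymmetry is no longer visible, but only one
integral has to be differentiated. -/
lemma InvForm.varpi_apply (B : InvForm I G) (x y : secA I G) :
    B.varpi ![x, y] = B.intPair (timeDeriv I G x) y - B.pair (evalAt I 0 x) (thetaLA I G y) -
      (1 / 2 : ℝ) • B.pair (thetaLA I G x) (thetaLA I G y) := by
  have h : B.varpi ![x, y] = -((1 / 2 : ℝ) • (B.intPair (-x) (timeDeriv I G (-y)) -
      B.intPair (-y) (timeDeriv I G (-x)))) - (1 / 2 : ℝ) •
      (B.pair (thetaLA I G x) (evalAt I 0 (-y)) - B.pair (thetaLA I G y) (evalAt I 0 (-x))) := rfl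
  have h1 := B.intPair_timeDeriv (x : LiePath I G) y
  rw [evalAt_one, evalAt_one, B.pair_AdFn] at h1
  have h2 := B.intPair_comm (y : LiePath I G) (timeDeriv I G x)
  have h3 := B.pair_comm (thetaLA I G y) (evalAt I 0 (x : LiePath I G))
  simp only [map_neg, map_add, LinearMap.neg_apply, LinearMap.add_apply] at h h1
  rw [h]
  linear_combination (norm := module) (-1 / 2 : ℝ) • h1 + (1 / 2 : ℝ) • h2 - (1 / 2 : ℝ) • h3

/-- The mixed terms are ½ of the t-derivative of ξ·α(a(ζ)), minus the same with ξ and ζ exchanged.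
Their boundary values provide exactly the terms -½ a^*θ^L·κ_0 of ϖ and ½ θ^L·α_0 of Q^α; the terms
θ^L(ξ)·θ^L(ζ) cancel by symmetry. -/
lemma InvForm.varpiConn_eq (B : InvForm I G) (α : ConnFamily I G) :
    B.varpiConn α = B.varpi + pullA (B.QConn α) := by
  refine alt2_ext fun x y => ?_
  -- The zeros are ℝ-components of elements j(·): of j(θ) where it is differentiated, of j(θ) on the
  -- bracket, and of j(F^θ).
  have h : B.varpiConn α ![x, y] =
      (derFn I (anchor I G x) 0 + B.intPair (timeDeriv I G x) (y + α.form (anchor I G y))) -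
      (derFn I (anchor I G y) 0 + B.intPair (timeDeriv I G y) (x + α.form (anchor I G x))) - 0 -
      (1 / 2 : ℝ) • (B.intPair (timeDeriv I G (x + α.form (anchor I G x)))
          (y + α.form (anchor I G y)) -
        B.intPair (timeDeriv I G (y + α.form (anchor I G y)))
          (x + α.form (anchor I G x))) - 0 := rfl
  have h' : (B.varpi + pullA (B.QConn α)) ![x, y] = B.varpi ![x, y] +
      ((1 / 2 : ℝ) • (B.pair (thetaLA I G x) (evalAt I 0 (α.form (anchor I G y))) -
        B.pair (thetaLA I G y) (evalAt I 0 (α.form (anchor I G x)))) +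
      (1 / 2 : ℝ) • (B.intPair (α.form (anchor I G x)) (timeDeriv I G (α.form (anchor I G y))) -
        B.intPair (α.form (anchor I G y)) (timeDeriv I G (α.form (anchor I G x))))) := rfl
  -- The condition on α_t at t = 0, with θ^R = Ad_g θ^L absorbed: α_1 = Ad_g(α_0 - θ^L).
  have e (x : secA I G) : evalAt I 1 (α.form (anchor I G x)) =
      AdFn I (evalAt I 0 (α.form (anchor I G x)) - thetaLA I G x) := by
    rw [map_sub, AdFn_thetaLA, ← thetaRForm_anchor]
    ext g
    have := α.periodic (anchor I G x) g 0
    rwa [zero_add] at this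
  rw [h, h', B.varpi_apply, ← vfDer_apply, ← vfDer_apply, map_zero, map_zero]
  have h1 := B.intPair_timeDeriv (x : LiePath I G) (α.form (anchor I G y))
  have h2 := B.intPair_timeDeriv (y : LiePath I G) (α.form (anchor I G x))
  have h3 := B.intPair_timeDeriv (x : LiePath I G) y
  rw [e, evalAt_one, B.pair_AdFn] at h1 h2
  rw [evalAt_one, evalAt_one, B.pair_AdFn] at h3
  have c1 := B.intPair_comm (timeDeriv I G (α.form (anchor I G y))) x
  have c2 := B.intPair_comm (timeDeriv I G (α.form (anchor I G x))) y
  have c3 := B.intPair_comm (timeDeriv I G y) (x : LiePath I G)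
  have c4 := B.intPair_comm (timeDeriv I G (α.form (anchor I G y))) (α.form (anchor I G x))
  have c5 := B.intPair_comm (timeDeriv I G (α.form (anchor I G x))) (α.form (anchor I G y))
  have c6 := B.pair_comm (thetaLA I G y) (evalAt I 0 (x : LiePath I G))
  have c7 := B.pair_comm (thetaLA I G y) (thetaLA I G x)
  have c8 := B.pair_comm (evalAt I 0 (y : LiePath I G)) (thetaLA I G x)
  simp only [map_add, map_sub, LinearMap.add_apply] at h1 h2 h3 ⊢
  linear_combination (norm := module) (1 / 2 : ℝ) • h1 - (1 / 2 : ℝ) • h2 - (1 / 2 : ℝ) • h3 +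
    (1 / 2 : ℝ) • c1 - (1 / 2 : ℝ) • c2 - (1 / 2 : ℝ) • c3 + (1 / 2 : ℝ) • c4 -
    (1 / 2 : ℝ) • c5 + (1 / 2 : ℝ) • c7 + (1 / 2 : ℝ) • c8

/-- The cyclic contribution of `(x, y, z)` to the differential of `ϖ`. -/
lemma InvForm.der_varpi_sub (B : InvForm I G) (x y z : secA I G) :
    derFn I (anchor I G x) (B.varpi ![y, z]) - B.varpi ![brA I G x y, z] =
      B.intPair (derPath I (anchor I G x) z) (timeDeriv I G y) +
      B.intPair (liePath I G (timeDeriv I G x) y) z +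
      B.intPair (liePath I G x (timeDeriv I G y)) z +
      B.intPair (derPath I (anchor I G y) (timeDeriv I G x)) z -
      B.pair (derLie I (anchor I G x) (thetaLA I G z)) (evalAt I 0 y) -
      (1 / 2 : ℝ) • B.pair (derLie I (anchor I G x) (thetaLA I G z)) (thetaLA I G y) -
      B.pair (lieFn I G (evalAt I 0 x) (evalAt I 0 y)) (thetaLA I G z) -
      B.pair (derLie I (anchor I G y) (evalAt I 0 x)) (thetaLA I G z) -
      (1 / 2 : ℝ) • B.pair (derLie I (anchor I G y) (thetaLA I G x)) (thetaLA I G z) +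
      (1 / 2 : ℝ) • B.pair (lieFn I G (thetaLA I G x) (thetaLA I G y)) (thetaLA I G z) := by
  have h1 : timeDeriv I G (brA I G x y : LiePath I G) =
      -(liePath I G (timeDeriv I G x) y + liePath I G x (timeDeriv I G y)) +
        derPath I (anchor I G x) (timeDeriv I G y) -
        derPath I (anchor I G y) (timeDeriv I G x) := by
    rw [← timeDeriv_liePath, ← timeDeriv_derPath, ← timeDeriv_derPath, ← map_neg, ← map_add,
      ← map_sub]
    rfl
  have h2 : evalAt I 0 (brA I G x y : LiePath I G) =
      -lieFn I G (evalAt I 0 x) (evalAt I 0 y) + derLie I (anchor I G x) (evalAt I 0 y) -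
        derLie I (anchor I G y) (evalAt I 0 x) := rfl
  have h3 : thetaLA I G (brA I G x y) = derLie I (anchor I G x) (thetaLA I G y) -
      -- Since the anchor preserves brackets, the Maurer–Cartan equation on G transfers to a^*θ^L.
      derLie I (anchor I G y) (thetaLA I G x) + lieFn I G (thetaLA I G x) (thetaLA I G y) :=
    (congrArg (thetaLForm I) (anchor_brA I x y)).trans (thetaLForm_brVF I _ _)
  have c1 := B.intPair_comm (timeDeriv I G (y : LiePath I G)) (derPath I (anchor I G x) z)
  have c2 := B.pair_comm (evalAt I 0 (y : LiePath I G)) (derLie I (anchor I G x) (thetaLA I G z))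
  have c3 := B.pair_comm (thetaLA I G y) (derLie I (anchor I G x) (thetaLA I G z))
  rw [← vfDer_apply, B.varpi_apply, B.varpi_apply, h1, h2, h3]
  simp only [map_sub, map_add, map_neg, Derivation.map_smul, vfDer_apply, B.derFn_pair,
    B.derFn_intPair, LinearMap.add_apply, LinearMap.sub_apply, LinearMap.neg_apply]
  -- The derivatives of y along a(x) cancel between the product rule and the term a(x)y of [x, y]_A;
  -- only derivatives of z along a(x) and of x along a(y) survive.
  linear_combination (norm := module) c1 - c2 - (1 / 2 : ℝ) • c3

/-- The integrand is the t-derivative of (a(y)x)·z. At t = 1 the derivative along a(y) also hits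
Ad_g, which produces the bracket with θ^L(a(y)). -/
lemma InvForm.intPair_derPath (B : InvForm I G) (x y z : secA I G) :
    B.intPair (derPath I (anchor I G y) (timeDeriv I G x)) z +
      B.intPair (derPath I (anchor I G y) x) (timeDeriv I G z) =
    B.pair (lieFn I G (thetaLA I G y) (evalAt I 0 x + thetaLA I G x) +
      derLie I (anchor I G y) (evalAt I 0 x) + derLie I (anchor I G y) (thetaLA I G x))
      (evalAt I 0 z + thetaLA I G z) -
    B.pair (derLie I (anchor I G y) (evalAt I 0 x)) (evalAt I 0 z) := by
  have h : evalAt I 1 (derPath I (anchor I G y) (x : LiePath I G)) =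
      derLie I (anchor I G y) (evalAt I 1 x) := rfl
  rw [← timeDeriv_derPath, B.intPair_timeDeriv, h, evalAt_one, evalAt_one, derLie_AdFn,
    B.pair_AdFn, derLie_add, add_assoc]
  rfl

/-- The integrand is the t-derivative of [x, y]·z; Ad_g is an automorphism preserving the form, so
it drops out at t = 1. -/
lemma InvForm.intPair_liePath_timeDeriv (B : InvForm I G) (x y z : secA I G) :
    B.intPair (liePath I G (timeDeriv I G x) y) z +
      B.intPair (liePath I G x (timeDeriv I G y)) z +
      B.intPair (liePath I G x y) (timeDeriv I G z) =
    B.pair (lieFn I G (evalAt I 0 x + thetaLA I G x) (evalAt I 0 y + thetaLA I G y))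
      (evalAt I 0 z + thetaLA I G z) -
    B.pair (lieFn I G (evalAt I 0 x) (evalAt I 0 y)) (evalAt I 0 z) := by
  have h := B.intPair_timeDeriv (liePath I G (x : LiePath I G) y) z
  have e (t : ℝ) : evalAt I t (liePath I G (x : LiePath I G) y) =
      lieFn I G (evalAt I t x) (evalAt I t y) := rfl
  rwa [timeDeriv_liePath, map_add, LinearMap.add_apply, e, e, evalAt_one, evalAt_one, evalAt_one,
    ← AdFn_lieFn, B.pair_AdFn] at h

/-- The cyclic sum of `der_varpi_sub` contains only total t-derivatives and boundary terms at t = 0,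
and `boundary_identity` evaluates their sum to η. -/
lemma InvForm.dA2_varpi (B : InvForm I G) : dA2 I G B.varpi = pullA B.eta := by
  ext1 v
  obtain ⟨x, hx⟩ : ∃ x, v 0 = x := ⟨_, rfl⟩
  obtain ⟨y, hy⟩ : ∃ y, v 1 = y := ⟨_, rfl⟩
  obtain ⟨z, hz⟩ : ∃ z, v 2 = z := ⟨_, rfl⟩
  have hl : dA2 I G B.varpi v = derFn I (anchor I G (v 0)) (B.varpi ![v 1, v 2]) -
      derFn I (anchor I G (v 1)) (B.varpi ![v 0, v 2]) +
      derFn I (anchor I G (v 2)) (B.varpi ![v 0, v 1]) -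
      B.varpi ![brA I G (v 0) (v 1), v 2] + B.varpi ![brA I G (v 0) (v 2), v 1] -
      B.varpi ![brA I G (v 1) (v 2), v 0] := rfl
  have hr : pullA B.eta v = (1 / 12 : ℝ) •
      (B.pair (thetaLA I G (v 0)) (lieFn I G (thetaLA I G (v 1)) (thetaLA I G (v 2)) -
        lieFn I G (thetaLA I G (v 2)) (thetaLA I G (v 1))) -
      B.pair (thetaLA I G (v 1)) (lieFn I G (thetaLA I G (v 0)) (thetaLA I G (v 2)) -
        lieFn I G (thetaLA I G (v 2)) (thetaLA I G (v 0))) +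
      B.pair (thetaLA I G (v 2)) (lieFn I G (thetaLA I G (v 0)) (thetaLA I G (v 1)) -
        lieFn I G (thetaLA I G (v 1)) (thetaLA I G (v 0)))) := rfl
  -- Replacing (x, z) by (z, x) in the middle terms turns the six-term formula for d into a sum over
  -- cyclic permutations.
  have hb : brA I G x z = -brA I G z x := (algA I).br_skew z x
  rw [hl, hr, hx, hy, hz, alt2_skew _ z x, ← vfDer_apply I (anchor I G y), map_neg, vfDer_apply,
    hb, alt2_neg]
  -- The identities are used backwards: η is expanded into boundary terms, and these into integrals
  -- over [0, 1], until both sides consist of the same kinds of terms.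
  rw [← boundary_identity B.pair (lieFn I G)
    (fun u v w => by rw [lieFn_skew u v, map_neg, LinearMap.neg_apply]) B.pair_cyclic B.pair_comm
    (evalAt I 0 x) (evalAt I 0 y) (evalAt I 0 z) (thetaLA I G x) (thetaLA I G y) (thetaLA I G z)
    (derLie I (anchor I G y) (evalAt I 0 x)) (derLie I (anchor I G y) (thetaLA I G x))
    (derLie I (anchor I G z) (evalAt I 0 y)) (derLie I (anchor I G z) (thetaLA I G y))
    (derLie I (anchor I G x) (evalAt I 0 z)) (derLie I (anchor I G x) (thetaLA I G z)),
    ← B.intPair_derPath x y z, ← B.intPair_derPath y z x, ← B.intPair_derPath z x y,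
    ← B.intPair_liePath_timeDeriv x y z]
  -- Each of [ẋ, y]·z, [x, ẏ]·z and [x, y]·ż occurs twice in the cyclic sum up to a cyclic rotation;
  -- this is the source of the factor 2 in `boundary_identity`.
  have t1 := B.intPair_cyclic (x : LiePath I G) (timeDeriv I G y) z
  have t2 := B.intPair_cyclic (x : LiePath I G) y (timeDeriv I G z)
  have t3 := B.intPair_cyclic (timeDeriv I G z) (x : LiePath I G) y
  have t4 := B.intPair_cyclic (z : LiePath I G) (timeDeriv I G x) y
  linear_combination (norm := module) B.der_varpi_sub x y z + B.der_varpi_sub y z x +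
    B.der_varpi_sub z x y - t1 - t2 + t3 + t4
end

/-! ### Invariance and the equivariant differential -/

section
variable {E : Type*} [NormedAddCommGroup E] [NormedSpace ℝ E]
  {H : Type*} [TopologicalSpace H] {I : ModelWithCorners ℝ E H} [I.Boundaryless]
  {G : Type*} [TopologicalSpace G] [ChartedSpace H G] [Group G] [LieGroup I ∞ G]
  [FiniteDimensional ℝ E]

lemma pullA_apply (om : (VF I G) [⋀^Fin 2]→ₗ[Fn I G] (Fn I G)) (x y : secA I G) :
    pullA om ![x, y] = om ![anchor I G x, anchor I G y] := by
  refine congrArg om (funext fun i => ?_)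
  fin_cases i <;> rfl

lemma InvariantA.add {om om' : (secA I G) [⋀^Fin 2]→ₗ[Fn I G] (Fn I G)} (h : InvariantA om)
    (h' : InvariantA om') : InvariantA (om + om') := fun k x y =>
  congrArg₂ (· + ·) (h k x y) (h' k x y)

lemma InvariantG.pullA {om : (VF I G) [⋀^Fin 2]→ₗ[Fn I G] (Fn I G)} (h : InvariantG om) :
    InvariantA (pullA om) := fun k x y => by
  rw [pullA_apply, pullA_apply, anchor_actA, anchor_actA, h]

lemma timeDeriv_actPath (k : G) (x : LiePath I G) :
    timeDeriv I G (actPath k x) = actPath k (timeDeriv I G x) := by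
  ext ⟨g, t⟩
  exact ((Ad I k).hasFDerivAt.comp_hasDerivAt t (hasDerivAt_path x (k⁻¹ * g * k) t)).deriv

lemma InvForm.intPair_actPath (B : InvForm I G) (k : G) (x y : LiePath I G) :
    B.intPair (actPath k x) (actPath k y) = actFn k (B.intPair x y) := by
  ext g
  exact intervalIntegral.integral_congr fun t _ => B.inv k _ _

/-- The transformation of the 𝔤-valued functions is assumed pointwise, which is the form in which
the equivariance of θ^L is available. -/
lemma InvForm.pair_act (B : InvForm I G) (k : G) {v w v' w' : LieFn I G}
    (hv : ∀ g, v' g = Ad I k (v (k⁻¹ * g * k))) (hw : ∀ g, w' g = Ad I k (w (k⁻¹ * g * k))) :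
    B.pair v' w' = actFn k (B.pair v w) := by
  ext g
  exact (congrArg₂ (fun a b => B.form a b) (hv g) (hw g)).trans (B.inv k _ _)

lemma thetaLA_actA (k : G) (x : secA I G) (g : G) :
    thetaLA I G (actA k x) g = Ad I k (thetaLA I G x (k⁻¹ * g * k)) :=
  (DFunLike.congr_fun (congrArg (thetaLForm I) (anchor_actA I k x)) g).trans
    (thetaLForm_actVF I k _ g)

/-- Every ingredient of `varpi_apply` transforms by Ad_k, and the form is Ad-invariant. -/
lemma InvForm.invariantA_varpi (B : InvForm I G) : InvariantA B.varpi := fun k x y => by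
  have h : B.intPair (timeDeriv I G (actA k x)) (actA k y) =
      actFn k (B.intPair (timeDeriv I G x) y) := by
    rw [← B.intPair_actPath, ← timeDeriv_actPath]; rfl
  rw [B.varpi_apply, B.varpi_apply, h,
    B.pair_act k (v := evalAt I 0 x) (w := thetaLA I G y) (fun _ => rfl) (thetaLA_actA k y),
    B.pair_act k (thetaLA_actA k x) (thetaLA_actA k y)]
  rfl

lemma InvForm.QConn_apply (B : InvForm I G) (α : ConnFamily I G) (X Y : VF I G) :
    B.QConn α ![X, Y] = (1 / 2 : ℝ) • (B.pair (thetaLForm I X) (evalAt I 0 (α.form Y)) -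
        B.pair (thetaLForm I Y) (evalAt I 0 (α.form X))) +
      (1 / 2 : ℝ) • (B.intPair (α.form X) (timeDeriv I G (α.form Y)) -
        B.intPair (α.form Y) (timeDeriv I G (α.form X))) := rfl

lemma InvForm.invariantG_QConn (B : InvForm I G) {α : ConnFamily I G} (hα : α.Invariant) :
    InvariantG (B.QConn α) := fun k X Y => by
  have h (X Y : VF I G) : B.pair (thetaLForm I (actVF k X)) (evalAt I 0 (actPath k (α.form Y))) =
      actFn k (B.pair (thetaLForm I X) (evalAt I 0 (α.form Y))) :=
    B.pair_act k (thetaLForm_actVF I k X) fun _ => rfl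
  rw [B.QConn_apply, B.QConn_apply, hα, hα, timeDeriv_actPath, timeDeriv_actPath,
    B.intPair_actPath, B.intPair_actPath, h, h]
  rfl

/-- Since x_A = -x is constant in t, the integral in `varpi_apply` vanishes. The rest is x·θ^L - ½(x
- Ad_{g⁻¹}x)·θ^L, and (Ad_{g⁻¹}x)·θ^L = x·θ^R by invariance. -/
lemma InvForm.contract_genA_varpi (B : InvForm I G) (x : LieAlg I G) :
    contract (R := Fn I G) (genA I G x) B.varpi = ((1 / 2 : ℝ) • (B.pair.flip (constLie I G x) ∘ₗ
      (thetaLForm I + thetaRForm I))) ∘ₗ anchor I G := by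
  ext1 y
  have hl : contract (R := Fn I G) (genA I G x) B.varpi y = B.varpi ![genA I G x, y] := rfl
  have hr : (((1 / 2 : ℝ) • (B.pair.flip (constLie I G x) ∘ₗ
      (thetaLForm I + thetaRForm I))) ∘ₗ anchor I G) y =
      (1 / 2 : ℝ) • B.pair (thetaLA I G y + thetaRForm I (anchor I G y)) (constLie I G x) := rfl
  have h0 : timeDeriv I G (genA I G x : LiePath I G) = 0 := by
    ext ⟨g, t⟩; exact deriv_const t (-x)
  have h1 : evalAt I 0 (genA I G x : LiePath I G) = -constLie I G x := rfl
  have h2 : AdFn I (thetaLA I G (genA I G x)) = -constLie I G x + AdFn I (constLie I G x) := by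
    rw [AdFn_thetaLA]
    ext g
    change -x - Ad I g (-x) = -x + Ad I g x
    rw [map_neg, sub_neg_eq_add]
  have h3 : AdFn I (thetaLA I G y) = thetaRForm I (anchor I G y) := AdFn_thetaLForm I _
  have h4 : B.pair (AdFn I (constLie I G x)) (thetaRForm I (anchor I G y)) =
      B.pair (constLie I G x) (thetaLA I G y) := by rw [← h3, B.pair_AdFn]
  -- Applying Ad_g to both factors of the last pairing avoids solving for θ^L(x_A): only Ad_g
  -- θ^L(x_A) = -x + Ad_g x is needed.
  rw [hl, hr, B.varpi_apply, h0, h1, ← B.pair_AdFn (thetaLA I G _), h2, h3, map_zero, map_neg,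
    map_add, map_add, map_neg, LinearMap.zero_apply, LinearMap.neg_apply, LinearMap.add_apply,
    LinearMap.add_apply, LinearMap.neg_apply, h4, B.pair_comm (thetaLA I G y),
    B.pair_comm (thetaRForm I _)]
  module

lemma InvForm.dEqA_varpi (B : InvForm I G) (x : LieAlg I G) :
    dEqA B.varpi x = pullEq (B.etaEq x) :=
  Prod.ext B.dA2_varpi (congrArg Neg.neg (B.contract_genA_varpi x))

lemma dEqA_add (om om' : (secA I G) [⋀^Fin 2]→ₗ[Fn I G] (Fn I G)) (x : LieAlg I G) :
    dEqA (om + om') x = dEqA om x + dEqA om' x := by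
  refine Prod.ext ?_ (neg_add (contract (R := Fn I G) (genA I G x) om)
    (contract (R := Fn I G) (genA I G x) om'))
  ext1 v
  change vfDer I G (anchor I G (v 0)) (om ![v 1, v 2] + om' ![v 1, v 2]) -
    vfDer I G (anchor I G (v 1)) (om ![v 0, v 2] + om' ![v 0, v 2]) +
    vfDer I G (anchor I G (v 2)) (om ![v 0, v 1] + om' ![v 0, v 1]) -
    (om ![brA I G (v 0) (v 1), v 2] + om' ![brA I G (v 0) (v 1), v 2]) +
    (om ![brA I G (v 0) (v 2), v 1] + om' ![brA I G (v 0) (v 2), v 1]) -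
    (om ![brA I G (v 1) (v 2), v 0] + om' ![brA I G (v 1) (v 2), v 0]) =
    (vfDer I G (anchor I G (v 0)) (om ![v 1, v 2]) -
    vfDer I G (anchor I G (v 1)) (om ![v 0, v 2]) +
    vfDer I G (anchor I G (v 2)) (om ![v 0, v 1]) -
    om ![brA I G (v 0) (v 1), v 2] + om ![brA I G (v 0) (v 2), v 1] -
    om ![brA I G (v 1) (v 2), v 0]) +
    (vfDer I G (anchor I G (v 0)) (om' ![v 1, v 2]) -
    vfDer I G (anchor I G (v 1)) (om' ![v 0, v 2]) +
    vfDer I G (anchor I G (v 2)) (om' ![v 0, v 1]) -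
    om' ![brA I G (v 0) (v 1), v 2] + om' ![brA I G (v 0) (v 2), v 1] -
    om' ![brA I G (v 1) (v 2), v 0])
  simp only [map_add]
  abel

/-- The 3-form component uses that the anchor preserves brackets, the 1-form component that it maps
x_A to x_G. -/
lemma dEqA_pullA (om : (VF I G) [⋀^Fin 2]→ₗ[Fn I G] (Fn I G)) (x : LieAlg I G) :
    dEqA (pullA om) x = pullEq (dEqG om x) := by
  have h : contract (R := Fn I G) (genA I G x) (pullA om) =
      contract (R := Fn I G) (genG I G x) om ∘ₗ anchor I G := by
    ext1 y
    exact (pullA_apply om _ _).trans (by rw [anchor_genA]; rfl)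
  exact Prod.ext (dA2_pullA om) (congrArg Neg.neg h)

lemma InvForm.dEqA_varpiConn (B : InvForm I G) (α : ConnFamily I G) (x : LieAlg I G) :
    dEqA (B.varpiConn α) x = pullEq (B.etaEq x + dEqG (B.QConn α) x) := by
  rw [B.varpiConn_eq, dEqA_add, B.dEqA_varpi, dEqA_pullA]
  rfl

end

end PathFibration
end

open PathFibration
/-- The `2`-forms on the Atiyah algebroid of the path fibration are primitives of the (pull-backs
of the) Cartan `3`-form and its equivariant extension. -/
theorem mainTheorem5 {E : Type*} [NormedAddCommGroup E] [NormedSpace ℝ E] [FiniteDimensional ℝ E]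
    {H : Type*} [TopologicalSpace H] (I : ModelWithCorners ℝ E H) [I.Boundaryless]
    (G : Type*) [TopologicalSpace G] [ChartedSpace H G] [Group G] [LieGroup I ∞ G]
    (B : InvForm I G) :
    (∀ α : ConnFamily I G,
      dA2 I G (B.varpiConn α) = pullA (B.eta + dG2 I G (B.QConn α))) ∧
    (∀ α : ConnFamily I G, α.Invariant →
      InvariantA (B.varpiConn α) ∧ InvariantG (B.QConn α) ∧
      ∀ x : LieAlg I G,
        dEqA (B.varpiConn α) x = pullEq (B.etaEq x + dEqG (B.QConn α) x)) ∧
    InvariantA B.varpi ∧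
    ∀ x : LieAlg I G, dEqA B.varpi x = pullEq (B.etaEq x) :=
  -- The 3-form component of the equivariant identity does not depend on the element of 𝔤, so it is
  -- read off at 0.
  ⟨fun α => congrArg Prod.fst (B.dEqA_varpiConn α 0), fun α hα =>
    ⟨B.varpiConn_eq α ▸ B.invariantA_varpi.add (B.invariantG_QConn hα).pullA,
      B.invariantG_QConn hα, B.dEqA_varpiConn α⟩, B.invariantA_varpi, B.dEqA_varpi⟩
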